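/- Let $0\le m\le n$, let $p,q>1$ with $\frac1p+\frac1q=1$, and let $U\subset\mathbb R^{n-m}$, $V\subset\mathbb R^m$ be domains (non-empty, open, connected). Let $u:U\times V\to\mathbb R^n$ be a $C^1$-diffeomorphism onto an open set, let $f$ be a $C^1$-diffeomorphism of $u(U\times V)$ onto an open set $\Omega\subset\mathbb R^n$, put $S_x=\{u(x,y): y\in V\}$ for $x\in U$, $\Sigma_0=\{S_x\}_{x\in U}$, and let $\Sigma=f(\Sigma_0)=\{\sigma_x\}_{x\in U}$ with $\sigma_x=f(S_x)$. A Borel function $\rho:\mathbb R^n\to[0,\infty]$ is admissible for a subfamily $\Sigma'\subset\Sigma$ if $\int_{\sigma}\rho\,dH^m\ge1$ for all $\sigma\in\Sigma'$, where $H^m$ is the $m$-dimensional Hausdorff measure, normalized so that it is Lebesgue measure on $\mathbb R^m$; $\mathrm{mod}_p(\Sigma')$ is the infimum of $\int_{\mathbb R^n}\rho^p\,dz$ over all admissible $\rho$. An admissible $\rho$ is extremal for $\Sigma$ if $\int\rho^p\,dz=\mathrm{mod}_p(\Sigma)$. It is extremal up to a subfamily of $p$-modulus zero if $\int\rho^p\,dz=\mathrm{mod}_p(\Sigma)$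 and $\rho$ is a Borel function that is admissible for $\Sigma\setminus N$ for some $N\subset\Sigma$ with $\mathrm{mod}_p(N)=0$. Let $I_f=J_{f\circ u}$ be the jacobian determinant of $f\circ u$, and let $|I_f^y|(x,y)=\sqrt{\det(A^{\top}A)}$, where $A$ is the jacobian matrix at $y$ of the map $V\ni y\mapsto f(u(x,y))$ with $x$ fixed. Put $$l(x)=\int_V\left(\frac{|I_f^y|}{|I_f|}\right)^q|I_f|\,dy\in(0,\infty],\qquad f_\Sigma(z)=\frac1{l(x)}\left(\frac{|I_f^y|}{|I_f|}\right)^{q-1}(x,y)\ \text{ for } z=f(u(x,y))\in\Omega,\qquad f_\Sigma(z)=0\ \text{ for } z\notin\Omega,$$ with the conventions $1/\infty=0$ and $\infty^{1-p}=0$. Then: 1. $I_f=(J_f\circ u)\,J_u$ on $U\times V$. 2. $\mathrm{mod}_p(\Sigma)=\int_U l(x)^{1-p}\,dx$ (both sides may be $0$ or $\infty$). 3. $f_\Sigma$ is extremal for the $p$-modulus of $\Sigma$ up to a subfamily of $p$-modulus zero; if $l(x)<\infty$ for every $x\in U$, it is admissible for all of $\Sigma$, hence extremal. 4. If $\mathrm{mod}_p(\Sigma)<\infty$,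 every function that is extremal for the $p$-modulus of $\Sigma$ up to a subfamily of $p$-modulus zero equals $f_\Sigma$ Lebesgue almost everywhere. -/

import Mathlib

open MeasureTheory Set
open scoped ENNReal

noncomputable section

namespace SurfaceModulus

/-- A Borel function `ρ : X → [0,∞]` is admissible for a family of (Borel) measures `S` if
`∫ ρ dμ ≥ 1` for every `μ ∈ S`. -/
def Admissible {X : Type*} [MeasurableSpace X] (S : Set (Measure X)) (ρ : X → ℝ≥0∞) : Prop :=
  Measurable ρ ∧ ∀ μ ∈ S, 1 ≤ ∫⁻ z, ρ z ∂μ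

/-- The Fuglede `p`-modulus of the family of measures `S` with respect to the measure `𝔪`
(the infimum is `∞` if there is no admissible function). -/
def modulus {X : Type*} [MeasurableSpace X] (p : ℝ) (𝔪 : Measure X) (S : Set (Measure X)) :
    ℝ≥0∞ :=
  ⨅ (ρ : X → ℝ≥0∞) (_ : Admissible S ρ), ∫⁻ z, ρ z ^ p ∂𝔪

/-- `ρ` is an extremal function for the `p`-modulus of `S`: it is admissible and realizes the
infimum. -/
def IsExtremal {X : Type*} [MeasurableSpace X] (p : ℝ) (𝔪 : Measure X) (S : Set (Measure X))
    (ρ : X → ℝ≥0∞) : Prop :=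
  Admissible S ρ ∧ ∫⁻ z, ρ z ^ p ∂𝔪 = modulus p 𝔪 S

/-- `ρ` is an extremal function for the `p`-modulus of `S` up to a subfamily of `p`-modulus zero:
it is admissible for `S` with such a subfamily removed, and `∫ ρ ^ p` equals the modulus of `S`. -/
def IsExtremalUpToNull {X : Type*} [MeasurableSpace X] (p : ℝ) (𝔪 : Measure X)
    (S : Set (Measure X)) (ρ : X → ℝ≥0∞) : Prop :=
  (∃ N ⊆ S, modulus p 𝔪 N = 0 ∧ Admissible (S \ N) ρ) ∧ ∫⁻ z, ρ z ^ p ∂𝔪 = modulus p 𝔪 S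

/-- `g` restricts to a `C¹`-diffeomorphism of the open set `A` onto an open set (its image). -/
def IsC1DiffeoOn {E F : Type*} [NormedAddCommGroup E] [NormedSpace ℝ E]
    [NormedAddCommGroup F] [NormedSpace ℝ F] (g : E → F) (A : Set E) : Prop :=
  IsOpen A ∧ IsOpen (g '' A) ∧ ContDiffOn ℝ 1 g A ∧
    ∃ h : F → E, ContDiffOn ℝ 1 h (g '' A) ∧ LeftInvOn h g A

/-- Euclidean space `ℝᵈ`. -/
abbrev Eu (d : ℕ) : Type := EuclideanSpace ℝ (Fin d)

/-- The (signed) jacobian determinant at `w = (x, y)` of a map `g` defined on (a subset of)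
`ℝᵏ × ℝᵐ = ℝᵏ⁺ᵐ` with values in `ℝᵏ⁺ᵐ`: the determinant of the jacobian matrix whose first `k`
columns are the partial derivatives in `x` and whose last `m` columns are those in `y`. -/
def jac {k m : ℕ} (g : Eu k × Eu m → Eu (k + m)) (w : Eu k × Eu m) : ℝ :=
  Matrix.det ((Matrix.fromCols
      (Matrix.of fun (i : Fin (k + m)) (j : Fin k) =>
        fderiv ℝ g w (EuclideanSpace.single j 1, 0) i)
      (Matrix.of fun (i : Fin (k + m)) (j : Fin m) =>
        fderiv ℝ g w (0, EuclideanSpace.single j 1) i)).submatrix id finSumFinEquiv.symm)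

/-- The jacobian `√(det (AᵀA))` at `y` of a map `h` defined on (a subset of) `ℝᵐ` with values in
`ℝⁿ`, where `A` is the jacobian matrix of `h` at `y`. -/
def gramJac {m n : ℕ} (h : Eu m → Eu n) (y : Eu m) : ℝ :=
  let A : Matrix (Fin n) (Fin m) ℝ :=
    Matrix.of fun i j => fderiv ℝ h y (EuclideanSpace.single j 1) i
  √((A.transpose * A).det)

/-- The jacobian at `(x, y)` of the map `g (x, ·)` with `x` fixed. -/
def jacY {k m : ℕ} (g : Eu k × Eu m → Eu (k + m)) (w : Eu k × Eu m) : ℝ :=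
  gramJac (fun y => g (w.1, y)) w.2

/-- The family of the `m`-dimensional surfaces `S_x = {u (x, y) | y ∈ V}`, `x ∈ U`. -/
def surfaces {k m : ℕ} (U : Set (Eu k)) (V : Set (Eu m))
    (u : Eu k × Eu m → Eu (k + m)) : Set (Set (Eu (k + m))) :=
  {S | ∃ x ∈ U, S = {z | ∃ y ∈ V, u (x, y) = z}}

/-- The images under `f` of the members of a family of surfaces. -/
def mapFamily {n : ℕ} (f : Eu n → Eu n) (S₀ : Set (Set (Eu n))) : Set (Set (Eu n)) :=
  {T | ∃ S ∈ S₀, T = f '' S}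

/-- The family of the `m`-dimensional Hausdorff measures (normalized so as to agree with Lebesgue
measure on `ℝᵐ`) on the members of a family of surfaces. -/
def surfaceMeasures {n : ℕ} (m : ℕ) (S : Set (Set (Eu n))) : Set (Measure (Eu n)) :=
  {μ | ∃ T ∈ S, μ = (Measure.euclideanHausdorffMeasure m).restrict T}

/-- The `p`-modulus, with respect to Lebesgue measure, of a family of `m`-dimensional surfaces. -/
def surfaceModulus {n : ℕ} (p : ℝ) (m : ℕ) (S : Set (Set (Eu n))) : ℝ≥0∞ :=
  modulus p volume (surfaceMeasures m S)

/-- `l(x) = ∫_V (|J^y_g| / |J_g|)^q |J_g| dy`, with values in `[0,∞]`. -/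
def ell {k m : ℕ} (q : ℝ) (V : Set (Eu m)) (g : Eu k × Eu m → Eu (k + m)) (x : Eu k) : ℝ≥0∞ :=
  ∫⁻ y in V, ENNReal.ofReal ((jacY g (x, y) / |jac g (x, y)|) ^ q * |jac g (x, y)|)

/-- The function `g (x, y) ↦ l(x)⁻¹ (|J^y_g| / |J_g|)^(q-1) (x, y)` on `g (U × V)`, extended by
zero, for `g` injective on `U × V`. -/
def density {k m : ℕ} (q : ℝ) (U : Set (Eu k)) (V : Set (Eu m))
    (g : Eu k × Eu m → Eu (k + m)) : Eu (k + m) → ℝ≥0∞ :=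
  (g '' (U ×ˢ V)).indicator fun z =>
    let w := Function.invFunOn g (U ×ˢ V) z
    (ell q V g w.1)⁻¹ * ENNReal.ofReal ((jacY g w / |jac g w|) ^ (q - 1))

end SurfaceModulus

end

/-! Put `g = f ∘ u`, `J = |J_g|` and `a = |J_g^y|`. In the coordinates `(x, y)`, Lebesgue measure on
the image is `J dx dy` (change of variables) and `H^m` on `σ_x` is `a dy` (area formula).
`IsFibered` records these facts, and the modulus is then computed abstractly.

Lower bound (`fiberEnergy_rpow_le`, `le_modulus`): Hölder on a fibre gives `1 ≤ ∫ F a dy ≤ (∫ F^p J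
dy)^(1/p) l(x)^(1/q)`. Since `p / q = p - 1`, this says `l(x)^(1-p) ≤ ∫ F^p J dy`, to be integrated
over `U`.

Upper bound (`IsFibered.extremal`): equality in Hölder means that `F` is proportional to `(a /
J)^(q-1)`. Normalizing by `1 / l` makes the fibre integrals one and, as `p (q - 1) = q`, the fibre
energy `l^(1-p)`. Where `l = ∞` this density vanishes and is not admissible, but those fibres have
modulus zero (`modulus_infinite_fibers`): truncated energies tend to infinity, so normalized
truncations can be made arbitrarily cheap, measurably in `x`.

Uniqueness (`IsExtremalUpToNull.ae_eq`): the midpoint of two extremal functions is again admissible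
up to a null family, and `t ↦ t^p` is strictly convex. -/

noncomputable section

namespace SurfaceModulus

/-! ### Null families and uniqueness of extremal functions -/

section Modulus

variable {X : Type*} [MeasurableSpace X] {S T N N' : Set (Measure X)} {ρ τ : X → ℝ≥0∞}
  {𝔪 : Measure X} {p : ℝ}

theorem Admissible.mono (h : Admissible T ρ) (hST : S ⊆ T) : Admissible S ρ :=
  ⟨h.1, fun μ hμ => h.2 μ (hST hμ)⟩

theorem Admissible.union_max (hρ : Admissible S ρ) (hτ : Admissible T τ) :
    Admissible (S ∪ T) (fun z => max (ρ z) (τ z)) := by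
  refine ⟨hρ.1.max hτ.1, ?_⟩
  rintro μ (hμ | hμ)
  · exact (hρ.2 μ hμ).trans (lintegral_mono fun z => le_max_left _ _)
  · exact (hτ.2 μ hμ).trans (lintegral_mono fun z => le_max_right _ _)

/-- At each point the maximum is one of the two functions. Using it in place of the sum avoids a
constant depending on `p`. -/
theorem lintegral_max_rpow_le (hρ : Measurable ρ) :
    ∫⁻ z, max (ρ z) (τ z) ^ p ∂𝔪 ≤ ∫⁻ z, ρ z ^ p ∂𝔪 + ∫⁻ z, τ z ^ p ∂𝔪 := by
  rw [← lintegral_add_left (hρ.pow_const p)]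
  refine lintegral_mono fun z => ?_
  dsimp only
  rcases le_total (ρ z) (τ z) with h | h
  · rw [max_eq_right h]; exact le_add_self
  · rw [max_eq_left h]; exact le_self_add

theorem modulus_le_lintegral (hρ : Admissible S ρ) : modulus p 𝔪 S ≤ ∫⁻ z, ρ z ^ p ∂𝔪 :=
  iInf₂_le ρ hρ

theorem exists_admissible_lintegral_lt {c : ℝ≥0∞} (h : modulus p 𝔪 S < c) :
    ∃ ρ, Admissible S ρ ∧ ∫⁻ z, ρ z ^ p ∂𝔪 < c := by
  simpa [modulus, iInf_lt_iff] using h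

/-- Families of modulus zero do not matter for upper bounds of the modulus. -/
theorem modulus_le_lintegral_of_diff (hN : modulus p 𝔪 N = 0)
    (hρ : Admissible (S \ N) ρ) : modulus p 𝔪 S ≤ ∫⁻ z, ρ z ^ p ∂𝔪 := by
  refine ENNReal.le_of_forall_pos_le_add fun ε hε _ => ?_
  obtain ⟨τ, hτ, hlt⟩ := exists_admissible_lintegral_lt (p := p) (𝔪 := 𝔪) (S := N) (c := ε)
    (by rw [hN]; exact_mod_cast hε)
  have hadm : Admissible S fun z => max (ρ z) (τ z) :=
    (hρ.union_max hτ).mono fun μ hμ => by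
      by_cases h : μ ∈ N
      · exact Or.inr h
      · exact Or.inl ⟨hμ, h⟩
  exact (modulus_le_lintegral hadm).trans
    ((lintegral_max_rpow_le hρ.1).trans (add_le_add_right hlt.le _))

theorem modulus_union_eq_zero (hN : modulus p 𝔪 N = 0) (hN' : modulus p 𝔪 N' = 0) :
    modulus p 𝔪 (N ∪ N') = 0 := by
  refine le_antisymm (ENNReal.le_of_forall_pos_le_add fun ε hε _ => ?_) zero_le
  obtain ⟨τ, hτ, hlt⟩ := exists_admissible_lintegral_lt (p := p) (𝔪 := 𝔪) (S := N) (c := ε)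
    (by rw [hN]; exact_mod_cast hε)
  have : modulus p 𝔪 (N ∪ N') ≤ ∫⁻ z, τ z ^ p ∂𝔪 :=
    modulus_le_lintegral_of_diff hN' (hτ.mono (by simp))
  simpa using this.trans hlt.le

theorem rpow_half_add_lt (hp : 1 < p) {a b : ℝ≥0∞} (ha : a ≠ ∞) (hb : b ≠ ∞) (hab : a ≠ b) :
    (2⁻¹ * (a + b)) ^ p < 2⁻¹ * (a ^ p + b ^ p) := by
  have hp0 : 0 ≤ p := by linarith
  lift a to NNReal using ha
  lift b to NNReal using hb
  have h2 : (2⁻¹ : ℝ≥0∞) = ((2⁻¹ : NNReal) : ℝ≥0∞) := by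
    rw [ENNReal.coe_inv two_ne_zero]; rfl
  rw [h2, ← ENNReal.coe_rpow_of_nonneg _ hp0, ← ENNReal.coe_rpow_of_nonneg _ hp0,
    ← ENNReal.coe_add, ← ENNReal.coe_add, ← ENNReal.coe_mul, ← ENNReal.coe_mul,
    ← ENNReal.coe_rpow_of_nonneg _ hp0, ENNReal.coe_lt_coe, ← NNReal.coe_lt_coe]
  have hab' : (a : ℝ) ≠ b := by exact_mod_cast hab
  have := (strictConvexOn_rpow hp).2 a.2 b.2 hab'
    (show (0 : ℝ) < 2⁻¹ by norm_num) (show (0 : ℝ) < 2⁻¹ by norm_num) (by norm_num)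
  simpa [mul_add] using this

theorem lintegral_half_add (μ : Measure X) (hρ : Measurable ρ) (hτ : Measurable τ) :
    ∫⁻ z, 2⁻¹ * (ρ z + τ z) ∂μ = 2⁻¹ * (∫⁻ z, ρ z ∂μ + ∫⁻ z, τ z ∂μ) := by
  rw [← lintegral_add_left hρ]
  exact lintegral_const_mul _ (hρ.add hτ)

/-- Extremal functions are unique almost everywhere when the modulus is finite. -/
theorem IsExtremalUpToNull.ae_eq (hp : 1 < p) (hfin : modulus p 𝔪 S ≠ ∞)
    (hρ : IsExtremalUpToNull p 𝔪 S ρ) (hτ : IsExtremalUpToNull p 𝔪 S τ) : ρ =ᵐ[𝔪] τ := by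
  have hp0 : 0 < p := by linarith
  obtain ⟨⟨N, -, hN, hρa⟩, hρe⟩ := hρ
  obtain ⟨⟨N', -, hN', hτa⟩, hτe⟩ := hτ
  have hρm := hρa.1
  have hτm := hτa.1
  have hadm : Admissible (S \ (N ∪ N')) fun z => 2⁻¹ * (ρ z + τ z) := by
    refine ⟨(hρm.add hτm).const_mul _, fun μ hμ => ?_⟩
    rw [lintegral_half_add μ hρm hτm]
    have h1 := hρa.2 μ ⟨hμ.1, fun h => hμ.2 (Or.inl h)⟩
    have h2 := hτa.2 μ ⟨hμ.1, fun h => hμ.2 (Or.inr h)⟩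
    calc (1 : ℝ≥0∞) = 2⁻¹ * (1 + 1) := by
          rw [one_add_one_eq_two, ENNReal.inv_mul_cancel two_ne_zero ENNReal.ofNat_ne_top]
      _ ≤ _ := by gcongr
  have hle := modulus_le_lintegral_of_diff (𝔪 := 𝔪) (modulus_union_eq_zero hN hN') hadm
  have hint : ∫⁻ z, 2⁻¹ * (ρ z ^ p + τ z ^ p) ∂𝔪 = modulus p 𝔪 S := by
    rw [lintegral_half_add 𝔪 (hρm.pow_const p) (hτm.pow_const p), hρe, hτe, ← two_mul, ← mul_assoc,
      ENNReal.inv_mul_cancel two_ne_zero ENNReal.ofNat_ne_top, one_mul]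
  have hρf : ∀ᵐ z ∂𝔪, ρ z ^ p < ∞ := ae_lt_top (hρm.pow_const p) (hρe ▸ hfin)
  have hτf : ∀ᵐ z ∂𝔪, τ z ^ p < ∞ := ae_lt_top (hτm.pow_const p) (hτe ▸ hfin)
  have hfin' : ∀ {a : ℝ≥0∞}, a ^ p < ∞ → a ≠ ∞ := fun h h' => by
    simp [h', ENNReal.top_rpow_of_pos hp0] at h
  have hconv : (fun z => (2⁻¹ * (ρ z + τ z)) ^ p) ≤ᵐ[𝔪] fun z => 2⁻¹ * (ρ z ^ p + τ z ^ p) := by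
    filter_upwards [hρf, hτf] with z h1 h2
    by_cases h : ρ z = τ z
    · rw [h, ← two_mul, ← two_mul, ← mul_assoc, ← mul_assoc,
        ENNReal.inv_mul_cancel two_ne_zero ENNReal.ofNat_ne_top, one_mul, one_mul]
    · exact (rpow_half_add_lt hp (hfin' h1) (hfin' h2) h).le
  -- The midpoint costs at least the modulus, which is the finite integral of its pointwise
  -- majorant. Hence the two agree almost everywhere, and strict convexity leaves only `ρ = τ`.
  have hae := ae_eq_of_ae_le_of_lintegral_le hconv
    (ne_top_of_le_ne_top (hint ▸ hfin) (lintegral_mono_ae hconv))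
    (((hρm.pow_const p).add (hτm.pow_const p)).const_mul _).aemeasurable (hint ▸ hle)
  filter_upwards [hρf, hτf, hae] with z h1 h2 h3
  by_contra h
  exact (rpow_half_add_lt hp (hfin' h1) (hfin' h2) h).ne h3

end Modulus

/-! ### Modulus of the fibres of a measured fibration -/

/-- A map `g : X × Y → Z`, considered on `U × V`, such that the measure `𝔪` on `g (U × V)` is
`J • (α × β)` and the measure `μ x` on the fibre over `x ∈ U` is `a (x, ·) • β` in the coordinates
given by `g`. -/
structure IsFibered {X Y Z : Type*} [MeasurableSpace X] [MeasurableSpace Y] [MeasurableSpace Z]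
    (α : Measure X) (β : Measure Y) (𝔪 : Measure Z) (U : Set X) (V : Set Y) (g : X × Y → Z)
    (J a : X × Y → ℝ≥0∞) (μ : X → Measure Z) : Prop where
  measurableSet_base : MeasurableSet U
  measurableSet_fiber : MeasurableSet V
  fiber_ne_zero : β V ≠ 0
  measurable_J : Measurable J
  measurable_a : Measurable a
  J_ne_zero : ∀ x ∈ U, ∀ y ∈ V, J (x, y) ≠ 0
  J_ne_top : ∀ x ∈ U, ∀ y ∈ V, J (x, y) ≠ ∞
  a_ne_zero : ∀ x ∈ U, ∀ y ∈ V, a (x, y) ≠ 0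
  a_ne_top : ∀ x ∈ U, ∀ y ∈ V, a (x, y) ≠ ∞
  lintegral_total : ∀ F : Z → ℝ≥0∞, Measurable F →
    ∫⁻ z in g '' (U ×ˢ V), F z ∂𝔪 = ∫⁻ x in U, ∫⁻ y in V, F (g (x, y)) * J (x, y) ∂β ∂α
  lintegral_fiber : ∀ x ∈ U, ∀ F : Z → ℝ≥0∞, Measurable F →
    ∫⁻ z, F z ∂μ x = ∫⁻ y in V, F (g (x, y)) * a (x, y) ∂β
  aemeasurable_fiber : ∀ x ∈ U, AEMeasurable (fun y => g (x, y)) (β.restrict V)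
  measurableSet_image : MeasurableSet (g '' (U ×ˢ V))
  exists_lift : ∀ G : X × Y → ℝ≥0∞, Measurable G → ∃ F : Z → ℝ≥0∞, Measurable F ∧
    (∀ w ∈ U ×ˢ V, F (g w) = G w) ∧ ∀ z ∉ g '' (U ×ˢ V), F z = 0

/-- The energy density `(a / J) ^ q * J` on `X × Y`. -/
def energy {W : Type*} (q : ℝ) (J a : W → ℝ≥0∞) (w : W) : ℝ≥0∞ := (a w / J w) ^ q * J w

/-- The integral of the energy density along the fibre over `x`. -/
def fiberEnergy {X Y : Type*} [MeasurableSpace Y] (q : ℝ) (β : Measure Y) (V : Set Y)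
    (J a : X × Y → ℝ≥0∞) (x : X) : ℝ≥0∞ := ∫⁻ y in V, energy q J a (x, y) ∂β

theorem inv_rpow_mul_self_le (p : ℝ) (hp : 0 < p) (c : ℝ≥0∞) : c⁻¹ ^ p * c ≤ c ^ (1 - p) := by
  rcases eq_or_ne c 0 with rfl | h0
  · simp
  rcases eq_or_ne c ∞ with rfl | ht
  · simp [hp]
  rw [ENNReal.inv_rpow, ← ENNReal.rpow_neg, sub_eq_neg_add, ENNReal.rpow_add _ _ h0 ht,
    ENNReal.rpow_one]

/-- At `c = ∞` both sides are zero. At `c = 0` equality would fail: the left side is `∞ * 0 = 0`,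
the right side is `∞`. -/
theorem inv_rpow_mul_self (p : ℝ) (hp : 1 < p) {c : ℝ≥0∞} (h0 : c ≠ 0) :
    c⁻¹ ^ p * c = c ^ (1 - p) := by
  rcases eq_or_ne c ∞ with rfl | ht
  · simp [show 0 < p by linarith, hp]
  rw [ENNReal.inv_rpow, ← ENNReal.rpow_neg, sub_eq_neg_add, ENNReal.rpow_add _ _ h0 ht,
    ENNReal.rpow_one]

namespace IsFibered

variable {X Y Z : Type*} [MeasurableSpace X] [MeasurableSpace Y] [MeasurableSpace Z]
  {α : Measure X} {β : Measure Y} {𝔪 : Measure Z} {U : Set X} {V : Set Y} {g : X × Y → Z}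
  {J a : X × Y → ℝ≥0∞} {μ : X → Measure Z} {p q : ℝ}

theorem measurable_ratio (h : IsFibered α β 𝔪 U V g J a μ) : Measurable fun w => a w / J w :=
  h.measurable_a.div h.measurable_J

theorem measurable_energy (h : IsFibered α β 𝔪 U V g J a μ) : Measurable (energy q J a) :=
  (h.measurable_ratio.pow_const q).mul h.measurable_J

theorem ratio_ne_zero (h : IsFibered α β 𝔪 U V g J a μ) {x : X} (hx : x ∈ U) {y : Y} (hy : y ∈ V) :
    a (x, y) / J (x, y) ≠ 0 :=
  (ENNReal.div_pos (h.a_ne_zero x hx y hy) (h.J_ne_top x hx y hy)).ne'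

theorem ratio_ne_top (h : IsFibered α β 𝔪 U V g J a μ) {x : X} (hx : x ∈ U) {y : Y} (hy : y ∈ V) :
    a (x, y) / J (x, y) ≠ ∞ :=
  ENNReal.div_ne_top (h.a_ne_top x hx y hy) (h.J_ne_zero x hx y hy)

theorem energy_ne_zero (h : IsFibered α β 𝔪 U V g J a μ) {x : X} (hx : x ∈ U) {y : Y}
    (hy : y ∈ V) : energy q J a (x, y) ≠ 0 :=
  mul_ne_zero (ENNReal.rpow_pos (h.ratio_ne_zero hx hy).bot_lt (h.ratio_ne_top hx hy)).ne'
    (h.J_ne_zero x hx y hy)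

theorem energy_ne_top (h : IsFibered α β 𝔪 U V g J a μ) (hq : 0 ≤ q) {x : X} (hx : x ∈ U) {y : Y}
    (hy : y ∈ V) : energy q J a (x, y) ≠ ∞ :=
  ENNReal.mul_ne_top (ENNReal.rpow_ne_top_of_nonneg hq (h.ratio_ne_top hx hy))
    (h.J_ne_top x hx y hy)

/-- The energy density is positive at every point of `V`, a set of positive measure. -/
theorem fiberEnergy_ne_zero (h : IsFibered α β 𝔪 U V g J a μ) {x : X} (hx : x ∈ U) :
    fiberEnergy q β V J a x ≠ 0 := by
  intro h0
  have hm : Measurable fun y => energy q J a (x, y) :=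
    h.measurable_energy.comp measurable_prodMk_left
  rw [fiberEnergy, lintegral_eq_zero_iff hm] at h0
  have := (ae_restrict_iff' h.measurableSet_fiber).1 h0
  refine h.fiber_ne_zero (measure_mono_null (fun y hy => ?_) (ae_iff.1 this))
  simpa [hy] using h.energy_ne_zero hx hy

/-- The Hölder inequality on a fibre. -/
theorem fiberEnergy_rpow_le (h : IsFibered α β 𝔪 U V g J a μ) (hpq : p.HolderConjugate q)
    {x : X} (hx : x ∈ U) {F : Z → ℝ≥0∞} (hF : Measurable F) (hF1 : 1 ≤ ∫⁻ z, F z ∂μ x) :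
    fiberEnergy q β V J a x ^ (1 - p) ≤ ∫⁻ y in V, F (g (x, y)) ^ p * J (x, y) ∂β := by
  have hp := hpq.pos
  have hq := hpq.symm.pos
  rcases eq_or_ne (fiberEnergy q β V J a x) ∞ with ht | ht
  · rw [ht, ENNReal.top_rpow_of_neg (by linarith [hpq.lt])]
    exact zero_le
  have hJm : Measurable fun y => J (x, y) := h.measurable_J.comp measurable_prodMk_left
  have hrm : Measurable fun y => a (x, y) / J (x, y) :=
    h.measurable_ratio.comp measurable_prodMk_left
  -- The weight is split as `J = J^(1/p) J^(1/q)`, so that `F a = (F J^(1/p)) ((a / J) J^(1/q))`.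
  have key := ENNReal.lintegral_mul_le_Lp_mul_Lq (β.restrict V) hpq
    (f := fun y => F (g (x, y)) * J (x, y) ^ (1 / p))
    (g := fun y => a (x, y) / J (x, y) * J (x, y) ^ (1 / q))
    ((hF.comp_aemeasurable (h.aemeasurable_fiber x hx)).mul (hJm.pow_const _).aemeasurable)
    (hrm.mul (hJm.pow_const _)).aemeasurable
  have e1 : ∫⁻ y in V, ((fun y => F (g (x, y)) * J (x, y) ^ (1 / p)) *
      fun y => a (x, y) / J (x, y) * J (x, y) ^ (1 / q)) y ∂β = ∫⁻ z, F z ∂μ x := by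
    rw [h.lintegral_fiber x hx F hF]
    refine setLIntegral_congr_fun h.measurableSet_fiber fun y hy => ?_
    have h0 := h.J_ne_zero x hx y hy
    have h1 := h.J_ne_top x hx y hy
    have : J (x, y) ^ (1 / p) * J (x, y) ^ (1 / q) = J (x, y) := by
      rw [← ENNReal.rpow_add _ _ h0 h1, one_div, one_div, hpq.inv_add_inv_eq_one,
        ENNReal.rpow_one]
    calc F (g (x, y)) * J (x, y) ^ (1 / p) * (a (x, y) / J (x, y) * J (x, y) ^ (1 / q))
        = F (g (x, y)) * (a (x, y) / J (x, y) * (J (x, y) ^ (1 / p) * J (x, y) ^ (1 / q))) := by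
          ring
      _ = F (g (x, y)) * a (x, y) := by rw [this, ENNReal.div_mul_cancel h0 h1]
  have e2 : ∫⁻ y in V, (F (g (x, y)) * J (x, y) ^ (1 / p)) ^ p ∂β
      = ∫⁻ y in V, F (g (x, y)) ^ p * J (x, y) ∂β := by
    simp_rw [ENNReal.mul_rpow_of_nonneg _ _ hp.le, ← ENNReal.rpow_mul,
      one_div_mul_cancel hp.ne', ENNReal.rpow_one]
  have e3 : ∫⁻ y in V, (a (x, y) / J (x, y) * J (x, y) ^ (1 / q)) ^ q ∂β
      = fiberEnergy q β V J a x := by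
    simp_rw [fiberEnergy, energy, ENNReal.mul_rpow_of_nonneg _ _ hq.le, ← ENNReal.rpow_mul,
      one_div_mul_cancel hq.ne', ENNReal.rpow_one]
  rw [e1, e2, e3] at key
  have key2 := ENNReal.rpow_le_rpow (hF1.trans key) hp.le
  rw [ENNReal.one_rpow, ENNReal.mul_rpow_of_nonneg _ _ hp.le, ← ENNReal.rpow_mul,
    ← ENNReal.rpow_mul, one_div_mul_cancel hp.ne', ENNReal.rpow_one,
    one_div_mul_eq_div, hpq.div_conj_eq_sub_one, mul_comm] at key2
  have h0 : fiberEnergy q β V J a x ≠ 0 := h.fiberEnergy_ne_zero hx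
  have hp1 : 0 < p - 1 := by linarith [hpq.lt]
  rw [← neg_sub, ENNReal.rpow_neg, ENNReal.inv_le_iff_le_mul]
  · exact key2
  · exact fun _ => (ENNReal.rpow_pos h0.bot_lt ht).ne'
  · exact fun e => absurd e (ENNReal.rpow_ne_top_of_nonneg hp1.le ht)

theorem le_modulus (h : IsFibered α β 𝔪 U V g J a μ) (hpq : p.HolderConjugate q) :
    ∫⁻ x in U, fiberEnergy q β V J a x ^ (1 - p) ∂α ≤ modulus p 𝔪 (μ '' U) := by
  refine le_iInf₂ fun F hF => ?_
  calc ∫⁻ x in U, fiberEnergy q β V J a x ^ (1 - p) ∂α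
      ≤ ∫⁻ x in U, ∫⁻ y in V, F (g (x, y)) ^ p * J (x, y) ∂β ∂α :=
        setLIntegral_mono' h.measurableSet_base fun x hx =>
          h.fiberEnergy_rpow_le hpq hx hF.1 (hF.2 _ (mem_image_of_mem μ hx))
    _ = ∫⁻ z in g '' (U ×ˢ V), F z ^ p ∂𝔪 := (h.lintegral_total _ (hF.1.pow_const p)).symm
    _ ≤ _ := setLIntegral_le_lintegral _ _

/-- The function `(a / J) ^ (q - 1)` on `A`, normalized to have integral one along each fibre. -/
def truncated (q : ℝ) (β : Measure Y) (V : Set Y) (J a : X × Y → ℝ≥0∞) (A : Set (X × Y))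
    (w : X × Y) : ℝ≥0∞ :=
  (∫⁻ y in V, A.indicator (energy q J a) (w.1, y) ∂β)⁻¹ *
    A.indicator (fun w => (a w / J w) ^ (q - 1)) w

theorem measurable_truncated [SFinite β] (h : IsFibered α β 𝔪 U V g J a μ) {A : Set (X × Y)}
    (hA : MeasurableSet A) : Measurable (truncated q β V J a A) :=
  ((h.measurable_energy.indicator hA).lintegral_prod_right'.comp measurable_fst).inv.mul
    ((h.measurable_ratio.pow_const _).indicator hA)

/-- The normalizing factor is constant on the fibre, and `p (q - 1) = q` turns the rest into the
energy density. No division by `J` is undone, so `x` need not lie in `U`. -/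
theorem lintegral_truncated_rpow_mul (h : IsFibered α β 𝔪 U V g J a μ)
    (hpq : p.HolderConjugate q) {A : Set (X × Y)} (hA : MeasurableSet A) (x : X) :
    ∫⁻ y in V, truncated q β V J a A (x, y) ^ p * J (x, y) ∂β =
      (∫⁻ y in V, A.indicator (energy q J a) (x, y) ∂β)⁻¹ ^ p *
        ∫⁻ y in V, A.indicator (energy q J a) (x, y) ∂β := by
  have hm : Measurable fun y => A.indicator (energy q J a) (x, y) :=
    (h.measurable_energy.indicator hA).comp measurable_prodMk_left
  rw [← lintegral_const_mul _ hm]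
  refine lintegral_congr fun y => ?_
  rw [truncated, ENNReal.mul_rpow_of_nonneg _ _ hpq.nonneg, mul_assoc]
  congr 1
  by_cases hy : (x, y) ∈ A
  · rw [indicator_of_mem hy, indicator_of_mem hy, ← ENNReal.rpow_mul,
      hpq.symm.sub_one_mul_conj, energy]
  · rw [indicator_of_notMem hy, indicator_of_notMem hy, ENNReal.zero_rpow_of_pos hpq.pos, zero_mul]

/-- With `r = a / J`, one has `r^(q-1) a = r^(q-1) r J = r^q J`; this needs `J` nonzero and finite,
hence `x ∈ U`. -/
theorem lintegral_truncated_mul (h : IsFibered α β 𝔪 U V g J a μ)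
    {A : Set (X × Y)} (hA : MeasurableSet A) {x : X} (hx : x ∈ U) :
    ∫⁻ y in V, truncated q β V J a A (x, y) * a (x, y) ∂β =
      (∫⁻ y in V, A.indicator (energy q J a) (x, y) ∂β)⁻¹ *
        ∫⁻ y in V, A.indicator (energy q J a) (x, y) ∂β := by
  have hm : Measurable fun y => A.indicator (energy q J a) (x, y) :=
    (h.measurable_energy.indicator hA).comp measurable_prodMk_left
  rw [← lintegral_const_mul _ hm]
  refine setLIntegral_congr_fun h.measurableSet_fiber fun y hy => ?_
  rw [truncated, mul_assoc]
  congr 1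
  by_cases hyA : (x, y) ∈ A
  · have h0 := h.ratio_ne_zero hx hy
    have h1 := h.ratio_ne_top hx hy
    rw [indicator_of_mem hyA, indicator_of_mem hyA, energy]
    calc (a (x, y) / J (x, y)) ^ (q - 1) * a (x, y)
        = (a (x, y) / J (x, y)) ^ (q - 1) * (a (x, y) / J (x, y) * J (x, y)) := by
          rw [ENNReal.div_mul_cancel (h.J_ne_zero x hx y hy) (h.J_ne_top x hx y hy)]
      _ = (a (x, y) / J (x, y)) ^ (q - 1) * (a (x, y) / J (x, y)) ^ (1 : ℝ) * J (x, y) := by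
          rw [ENNReal.rpow_one, mul_assoc]
      _ = _ := by rw [← ENNReal.rpow_add _ _ h0 h1, sub_add_cancel]
  · rw [indicator_of_notMem hyA, indicator_of_notMem hyA, zero_mul]

theorem lintegral_of_lift (h : IsFibered α β 𝔪 U V g J a μ) {F : Z → ℝ≥0∞} {G : X × Y → ℝ≥0∞}
    (hp : 0 < p) (hF : Measurable F) (hFG : ∀ w ∈ U ×ˢ V, F (g w) = G w)
    (hF0 : ∀ z ∉ g '' (U ×ˢ V), F z = 0) :
    ∫⁻ z, F z ^ p ∂𝔪 = ∫⁻ x in U, ∫⁻ y in V, G (x, y) ^ p * J (x, y) ∂β ∂α := by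
  have hsupp : (g '' (U ×ˢ V)).indicator (fun z => F z ^ p) = fun z => F z ^ p := by
    refine indicator_eq_self.2 fun z hz => ?_
    by_contra hz'
    simp [hF0 z hz', hp] at hz
  rw [← hsupp, lintegral_indicator h.measurableSet_image, h.lintegral_total _ (hF.pow_const p)]
  refine setLIntegral_congr_fun h.measurableSet_base fun x hx =>
    setLIntegral_congr_fun h.measurableSet_fiber fun y hy => ?_
  rw [hFG (x, y) ⟨hx, hy⟩]

theorem lintegral_fiber_of_lift (h : IsFibered α β 𝔪 U V g J a μ) {F : Z → ℝ≥0∞}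
    {G : X × Y → ℝ≥0∞} (hF : Measurable F) (hFG : ∀ w ∈ U ×ˢ V, F (g w) = G w) {x : X}
    (hx : x ∈ U) : ∫⁻ z, F z ∂μ x = ∫⁻ y in V, G (x, y) * a (x, y) ∂β := by
  rw [h.lintegral_fiber x hx F hF]
  refine setLIntegral_congr_fun h.measurableSet_fiber fun y hy => ?_
  rw [hFG (x, y) ⟨hx, hy⟩]

/-- A truncation on which the energy density is bounded and has support of finite measure in each
fibre. -/
def level (β : Measure Y) [SigmaFinite β] (q : ℝ) (J a : X × Y → ℝ≥0∞) (j : ℕ) : Set (X × Y) :=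
  {w | w.2 ∈ spanningSets β j ∧ energy q J a w ≤ j}

variable [SigmaFinite β]

theorem measurableSet_level (h : IsFibered α β 𝔪 U V g J a μ) (j : ℕ) :
    MeasurableSet (level β q J a j) :=
  (measurable_snd (measurableSet_spanningSets β j)).inter
    (measurableSet_le h.measurable_energy measurable_const)

theorem level_mono : Monotone (level β q J a) := fun i j hij w hw =>
  ⟨monotone_spanningSets β hij hw.1, hw.2.trans (by exact_mod_cast hij)⟩

theorem lintegral_level_ne_top (j : ℕ) (x : X) :
    ∫⁻ y in V, (level β q J a j).indicator (energy q J a) (x, y) ∂β ≠ ∞ := by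
  refine ne_top_of_le_ne_top (b := ∫⁻ y, (spanningSets β j).indicator (fun _ => (j : ℝ≥0∞)) y ∂β)
    ?_ ((setLIntegral_le_lintegral _ _).trans (lintegral_mono fun y => ?_))
  · rw [lintegral_indicator_const (measurableSet_spanningSets β j)]
    exact ENNReal.mul_ne_top (by simp) (measure_spanningSets_lt_top β j).ne
  · by_cases hy : (x, y) ∈ level β q J a j
    · rw [indicator_of_mem hy, indicator_of_mem hy.1]
      exact hy.2
    · rw [indicator_of_notMem hy]
      exact zero_le

/-- Monotone convergence: the energy density is finite at each point of the fibre, so the levels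
exhaust it. -/
theorem iSup_lintegral_level (h : IsFibered α β 𝔪 U V g J a μ) (hq : 0 ≤ q) {x : X} (hx : x ∈ U) :
    ⨆ j, ∫⁻ y in V, (level β q J a j).indicator (energy q J a) (x, y) ∂β =
      fiberEnergy q β V J a x := by
  rw [← lintegral_iSup]
  · refine setLIntegral_congr_fun h.measurableSet_fiber fun y hy => ?_
    refine le_antisymm (iSup_le fun j => indicator_le_self _ _ _) ?_
    obtain ⟨n, hn⟩ := ENNReal.exists_nat_gt (h.energy_ne_top hq hx hy)
    have hmem : (x, y) ∈ level β q J a (max n (spanningSetsIndex β y)) :=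
      ⟨monotone_spanningSets β (le_max_right _ _) (mem_spanningSetsIndex β y),
        hn.le.trans (by exact_mod_cast le_max_left _ _)⟩
    refine le_iSup_of_le (max n (spanningSetsIndex β y)) ?_
    rw [indicator_of_mem hmem]
  · exact fun j => (h.measurable_energy.indicator (h.measurableSet_level j)).comp
      measurable_prodMk_left
  · exact fun i j hij y => indicator_le_indicator_of_subset (level_mono hij) (fun _ => zero_le) _

theorem exists_level_rpow_le (h : IsFibered α β 𝔪 U V g J a μ) (hpq : p.HolderConjugate q)
    {x : X} (hx : x ∈ U) (ht : fiberEnergy q β V J a x = ∞) {c : ℝ≥0∞} (hc : c ≠ 0) :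
    ∃ j, (∫⁻ y in V, (level β q J a j).indicator (energy q J a) (x, y) ∂β) ^ (1 - p) ≤ c := by
  have hp : 0 < p - 1 := by linarith [hpq.lt]
  rw [← h.iSup_lintegral_level hpq.symm.nonneg hx, iSup_eq_top] at ht
  rcases eq_or_ne c ∞ with rfl | hct
  · exact ⟨0, le_top⟩
  -- The threshold solves `t^(1-p) = c`; as `1 - p < 0`, any truncated energy above it will do.
  have hlt : c⁻¹ ^ (p - 1)⁻¹ < ∞ :=
    (ENNReal.rpow_ne_top_of_nonneg (inv_nonneg.2 hp.le) (ENNReal.inv_ne_top.2 hc)).lt_top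
  obtain ⟨j, hj⟩ := ht _ hlt
  refine ⟨j, ?_⟩
  rw [← neg_sub, ENNReal.rpow_neg, ENNReal.inv_le_iff_inv_le]
  have := ENNReal.rpow_le_rpow hj.le hp.le
  rwa [← ENNReal.rpow_mul, inv_mul_cancel₀ hp.ne', ENNReal.rpow_one] at this

/-- The fibres of infinite energy form a family of modulus zero. -/
theorem modulus_infinite_fibers [SigmaFinite α] (h : IsFibered α β 𝔪 U V g J a μ)
    (hpq : p.HolderConjugate q) :
    modulus p 𝔪 (μ '' {x ∈ U | fiberEnergy q β V J a x = ∞}) = 0 := by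
  classical
  refine le_antisymm (ENNReal.le_of_forall_pos_le_add fun ε hε _ => ?_) zero_le
  -- `w x` is the budget allowed on the fibre over `x`: positive everywhere, with total less than
  -- `ε`.
  obtain ⟨w, hw0, hwm, hwε⟩ := exists_pos_lintegral_lt_of_sigmaFinite α
    (ENNReal.coe_ne_zero.2 hε.ne')
  let L : ℕ → X → ℝ≥0∞ := fun j x =>
    ∫⁻ y in V, (level β q J a j).indicator (energy q J a) (x, y) ∂β
  have hLm : ∀ j, Measurable (L j) := fun j =>
    (h.measurable_energy.indicator (h.measurableSet_level j)).lintegral_prod_right'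
  let B : ℕ → Set X := fun j => {x | L j x ^ (1 - p) ≤ w x}
  have hBm : ∀ j, MeasurableSet (B j) := fun j =>
    measurableSet_le ((hLm j).pow_const _) hwm.coe_nnreal_ennreal
  -- `D j` consists of the `x` for which `j` is the first level within budget, a measurable choice
  -- of truncation.
  let D : ℕ → Set X := disjointed B
  have hDm : ∀ j, MeasurableSet (D j) := fun j => MeasurableSet.disjointed hBm j
  let A : Set (X × Y) := ⋃ j, (Prod.fst ⁻¹' D j) ∩ level β q J a j
  have hA : MeasurableSet A := MeasurableSet.iUnion fun j =>
    (measurable_fst (hDm j)).inter (h.measurableSet_level j)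
  have hslice : ∀ j, ∀ x ∈ D j,
      ∫⁻ y in V, A.indicator (energy q J a) (x, y) ∂β = L j x := by
    intro j x hx
    refine lintegral_congr fun y => ?_
    have : (x, y) ∈ A ↔ (x, y) ∈ level β q J a j := by
      refine ⟨fun hxy => ?_, fun hxy => mem_iUnion.2 ⟨j, hx, hxy⟩⟩
      obtain ⟨i, hi, hi'⟩ := mem_iUnion.1 hxy
      have hij : i = j := by
        by_contra hne
        exact (disjoint_left.1 (disjoint_disjointed B hne) hi) hx
      exact hij ▸ hi'
    by_cases hy : (x, y) ∈ A
    · rw [indicator_of_mem hy, indicator_of_mem (this.1 hy)]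
    · rw [indicator_of_notMem hy, indicator_of_notMem (mt this.2 hy)]
  have hL0 : ∀ j, ∀ x ∈ D j, L j x ≠ 0 := by
    intro j x hx h0
    have : L j x ^ (1 - p) ≤ w x := disjointed_subset B j hx
    rw [h0, ENNReal.zero_rpow_of_neg (by linarith [hpq.lt])] at this
    exact ENNReal.coe_ne_top (top_le_iff.1 this)
  obtain ⟨F, hF, hFG, hF0⟩ := h.exists_lift _ (h.measurable_truncated (q := q) hA)
  have hadm : Admissible (μ '' {x ∈ U | fiberEnergy q β V J a x = ∞}) F := by
    refine ⟨hF, ?_⟩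
    rintro _ ⟨x, ⟨hx, hxt⟩, rfl⟩
    obtain ⟨i, hi⟩ := h.exists_level_rpow_le hpq hx hxt (c := w x) (by exact_mod_cast (hw0 x).ne')
    have hxB : x ∈ ⋃ j, D j := by
      rw [iUnion_disjointed]
      exact mem_iUnion.2 ⟨i, hi⟩
    obtain ⟨j, hj⟩ := mem_iUnion.1 hxB
    rw [h.lintegral_fiber_of_lift hF hFG hx, h.lintegral_truncated_mul hA hx, hslice j x hj,
      ENNReal.inv_mul_cancel (hL0 j x hj) (lintegral_level_ne_top j x)]
  rw [zero_add]
  calc modulus p 𝔪 _ ≤ ∫⁻ z, F z ^ p ∂𝔪 := modulus_le_lintegral hadm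
    _ = ∫⁻ x in U, ∫⁻ y in V, truncated q β V J a A (x, y) ^ p * J (x, y) ∂β ∂α :=
        h.lintegral_of_lift hpq.pos hF hFG hF0
    _ ≤ ∫⁻ x in U, w x ∂α := by
        refine lintegral_mono fun x => ?_
        rw [h.lintegral_truncated_rpow_mul hpq hA]
        by_cases hx : x ∈ ⋃ j, D j
        · obtain ⟨j, hj⟩ := mem_iUnion.1 hx
          rw [hslice j x hj]
          exact (inv_rpow_mul_self_le p hpq.pos _).trans (disjointed_subset B j hj)
        -- If no level meets the budget, `A` has empty slice over `x` and the fibre costs nothing.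
        · have : ∫⁻ y in V, A.indicator (energy q J a) (x, y) ∂β = 0 := by
            rw [← lintegral_zero (μ := β.restrict V)]
            refine lintegral_congr fun y => indicator_of_notMem (fun hy => hx ?_) _
            obtain ⟨i, hi, -⟩ := mem_iUnion.1 hy
            exact mem_iUnion.2 ⟨i, hi⟩
          rw [this, mul_zero]
          exact zero_le
    _ ≤ ε := (setLIntegral_le_lintegral _ _).trans hwε.le

/-- The function on the total space that is normalized to have integral one along each fibre of
finite energy. -/
theorem extremal (h : IsFibered α β 𝔪 U V g J a μ) [SigmaFinite α] (hpq : p.HolderConjugate q)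
    {F : Z → ℝ≥0∞}
    (hFG : ∀ w ∈ U ×ˢ V, F (g w) =
      (fiberEnergy q β V J a w.1)⁻¹ * (a w / J w) ^ (q - 1))
    (hF0 : ∀ z ∉ g '' (U ×ˢ V), F z = 0) :
    modulus p 𝔪 (μ '' U) = ∫⁻ x in U, fiberEnergy q β V J a x ^ (1 - p) ∂α ∧
    IsExtremalUpToNull p 𝔪 (μ '' U) F ∧
    ((∀ x ∈ U, fiberEnergy q β V J a x ≠ ∞) → IsExtremal p 𝔪 (μ '' U) F) := by
  -- The extremal candidate is the case without truncation, so the integrals computed above apply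
  -- with `A = univ`.
  have hFG' : ∀ w ∈ U ×ˢ V, F (g w) = truncated q β V J a univ w := fun w hw => by
    rw [hFG w hw, truncated, indicator_univ, indicator_univ, fiberEnergy]
  obtain ⟨F', hF', hF'G, hF'0⟩ := h.exists_lift _ (h.measurable_truncated (q := q) .univ)
  have hF : Measurable F := by
    convert hF' using 1
    funext z
    by_cases hz : z ∈ g '' (U ×ˢ V)
    · obtain ⟨w, hw, rfl⟩ := hz
      rw [hFG' w hw, hF'G w hw]
    · rw [hF0 z hz, hF'0 z hz]
  have hE : ∀ x, ∫⁻ y in V, univ.indicator (energy q J a) (x, y) ∂β = fiberEnergy q β V J a x :=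
    fun x => by rw [indicator_univ, fiberEnergy]
  have hadm : Admissible
      (μ '' U \ μ '' {x ∈ U | fiberEnergy q β V J a x = ∞}) F := by
    refine ⟨hF, ?_⟩
    rintro _ ⟨⟨x, hx, rfl⟩, hx'⟩
    have hxt : fiberEnergy q β V J a x ≠ ∞ := fun e => hx' (mem_image_of_mem μ ⟨hx, e⟩)
    rw [h.lintegral_fiber_of_lift hF hFG' hx, h.lintegral_truncated_mul .univ hx, hE,
      ENNReal.inv_mul_cancel (h.fiberEnergy_ne_zero hx) hxt]
  have hint : ∫⁻ z, F z ^ p ∂𝔪 = ∫⁻ x in U, fiberEnergy q β V J a x ^ (1 - p) ∂α := by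
    rw [h.lintegral_of_lift hpq.pos hF hFG' hF0]
    refine setLIntegral_congr_fun h.measurableSet_base fun x hx => ?_
    rw [h.lintegral_truncated_rpow_mul hpq .univ, hE,
      inv_rpow_mul_self p hpq.lt (h.fiberEnergy_ne_zero hx)]
  have hmod : modulus p 𝔪 (μ '' U) = ∫⁻ x in U, fiberEnergy q β V J a x ^ (1 - p) ∂α :=
    le_antisymm (hint ▸ modulus_le_lintegral_of_diff (h.modulus_infinite_fibers hpq) hadm)
      (h.le_modulus hpq)
  have hsub : {x ∈ U | fiberEnergy q β V J a x = ∞} ⊆ U := fun x hx => hx.1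
  refine ⟨hmod, ⟨⟨_, image_mono hsub, h.modulus_infinite_fibers hpq, hadm⟩, hint.trans hmod.symm⟩,
    fun hfin => ⟨hadm.mono ?_, hint.trans hmod.symm⟩⟩
  have : {x ∈ U | fiberEnergy q β V J a x = ∞} = ∅ :=
    eq_empty_of_forall_notMem fun x hx => hfin x hx.1 hx.2
  rw [this, image_empty, sdiff_empty]

end IsFibered

/-! ### Area formula: distortion of Hausdorff measure and auxiliary estimates -/

section AreaFormula

open Filter Topology

variable {E X Y : Type*} [EMetricSpace X] [MeasurableSpace X] [BorelSpace X]
  [EMetricSpace Y] [MeasurableSpace Y] [BorelSpace Y]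

theorem euclideanHausdorffMeasure_image_le_of_lipschitzOnWith {f : X → Y} {s : Set X} {c : NNReal}
    (hf : LipschitzOnWith c f s) (d : ℕ) : μHE[d] (f '' s) ≤ c ^ d * μHE[d] s := by
  simp only [Measure.euclideanHausdorffMeasure_def, Measure.smul_apply, ENNReal.smul_def,
    smul_eq_mul]
  have := hf.hausdorffMeasure_image_le (d := d) (by positivity)
  rw [ENNReal.rpow_natCast] at this
  rw [mul_left_comm]
  gcongr

/-- The map `g a ↦ f a` is `c`-Lipschitz on `g '' s`. Injectivity of `g` is not needed: by the
hypothesis `g a = g b` forces `f a = f b`. -/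
theorem euclideanHausdorffMeasure_image_le_of_edist_le {f : E → X} {g : E → Y} {s : Set E}
    {c : NNReal} (h : ∀ a ∈ s, ∀ b ∈ s, edist (f a) (f b) ≤ c * edist (g a) (g b)) (d : ℕ) :
    μHE[d] (f '' s) ≤ c ^ d * μHE[d] (g '' s) := by
  rcases isEmpty_or_nonempty E with hE | hE
  · simp [eq_empty_of_isEmpty s]
  have hmem : ∀ a ∈ s, Function.invFunOn g s (g a) ∈ s := fun a ha =>
    Function.invFunOn_mem ⟨a, ha, rfl⟩
  have heq : ∀ a ∈ s, g (Function.invFunOn g s (g a)) = g a := fun a ha =>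
    Function.invFunOn_eq ⟨a, ha, rfl⟩
  have hL : LipschitzOnWith c (f ∘ Function.invFunOn g s) (g '' s) := by
    rintro _ ⟨a, ha, rfl⟩ _ ⟨b, hb, rfl⟩
    simpa [heq a ha, heq b hb] using h _ (hmem a ha) _ (hmem b hb)
  have himg : (f ∘ Function.invFunOn g s) '' (g '' s) = f '' s := by
    rw [image_image]
    refine image_congr fun a ha => ?_
    have := h _ (hmem a ha) _ ha
    rw [heq a ha, edist_self, mul_zero] at this
    exact edist_eq_zero.1 (le_antisymm this zero_le)
  rw [← himg]
  exact euclideanHausdorffMeasure_image_le_of_lipschitzOnWith hL d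

/-- Near a point with injective strict derivative `A`, the map distorts distances by at most an
arbitrarily small factor compared with `A`. -/
theorem _root_.HasStrictFDerivAt.eventually_edist_le {E F : Type*} [NormedAddCommGroup E]
    [NormedSpace ℝ E] [FiniteDimensional ℝ E] [NormedAddCommGroup F] [NormedSpace ℝ F]
    {f : E → F} {A : E →L[ℝ] F} {y : E} (hf : HasStrictFDerivAt f A y)
    (hA : Function.Injective A) {c : NNReal} (hc : 1 < c) :
    ∀ᶠ z : E × E in 𝓝 (y, y), edist (f z.1) (f z.2) ≤ c * edist (A z.1) (A z.2) ∧
      edist (A z.1) (A z.2) ≤ c * edist (f z.1) (f z.2) := by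
  obtain ⟨K, hK, hAK⟩ := A.toLinearMap.exists_antilipschitzWith (LinearMap.ker_eq_bot.2 hA)
  have hc' : (1 : ℝ) < c := by exact_mod_cast hc
  have hK' : (0 : ℝ) < K := by exact_mod_cast hK
  have hη : 0 < 1 - (c : ℝ)⁻¹ := sub_pos.2 (inv_lt_one_of_one_lt₀ hc')
  -- The constant is chosen so that, with `‖z.1 - z.2‖ ≤ K ‖v‖`, the error is at most `(1 - c⁻¹)
  -- ‖v‖`. Then `c⁻¹ ‖v‖ ≤ ‖f z.1 - f z.2‖ ≤ (2 - c⁻¹) ‖v‖`, and `2 - c⁻¹ ≤ c`.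
  filter_upwards [hf.isLittleO.def (div_pos hη hK')] with z hz
  have hanti : ‖z.1 - z.2‖ ≤ K * ‖A (z.1 - z.2)‖ := by
    simpa [dist_eq_norm] using hAK.le_mul_dist z.1 z.2
  set v := A (z.1 - z.2) with hv
  have hz' : ‖f z.1 - f z.2 - v‖ ≤ (1 - (c : ℝ)⁻¹) * ‖v‖ :=
    calc _ ≤ (1 - (c : ℝ)⁻¹) / K * ‖z.1 - z.2‖ := hz
      _ ≤ (1 - (c : ℝ)⁻¹) / K * (K * ‖v‖) := by gcongr
      _ = _ := by field_simp
  have hsum : (c : ℝ) * (c : ℝ)⁻¹ = 1 := mul_inv_cancel₀ (by positivity)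
  have h1 : ‖f z.1 - f z.2‖ ≤ c * ‖v‖ := by
    have := norm_le_norm_add_norm_sub' (f z.1 - f z.2) v
    have h3 : 2 - (c : ℝ)⁻¹ ≤ c := by
      have : (c : ℝ)⁻¹ * (c - 1) ^ 2 = c - (2 - (c : ℝ)⁻¹) := by field_simp; ring
      have h4 : 0 ≤ (c : ℝ)⁻¹ * (c - 1) ^ 2 := by positivity
      linarith
    nlinarith [norm_nonneg v]
  have h2 : ‖v‖ ≤ c * ‖f z.1 - f z.2‖ := by
    have := norm_le_norm_add_norm_sub' v (f z.1 - f z.2)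
    rw [norm_sub_rev v] at this
    have h3 : (c : ℝ)⁻¹ * ‖v‖ ≤ ‖f z.1 - f z.2‖ := by linarith
    calc ‖v‖ = c * ((c : ℝ)⁻¹ * ‖v‖) := by rw [← mul_assoc, hsum, one_mul]
      _ ≤ _ := by gcongr
  have hAv : edist (A z.1) (A z.2) = ENNReal.ofReal ‖v‖ := by
    rw [edist_dist, dist_eq_norm, hv, map_sub]
  have hfv : edist (f z.1) (f z.2) = ENNReal.ofReal ‖f z.1 - f z.2‖ := by
    rw [edist_dist, dist_eq_norm]
  rw [hAv, hfv, ← ENNReal.ofReal_coe_nnreal, ← ENNReal.ofReal_mul c.coe_nonneg,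
    ← ENNReal.ofReal_mul c.coe_nonneg]
  exact ⟨ENNReal.ofReal_le_ofReal h1, ENNReal.ofReal_le_ofReal h2⟩

/-- `AᵀA` is the Gram matrix of the images of the standard basis; `normDet` is the factor by which a
linear map scales `m`-dimensional Hausdorff measure. -/
theorem gramJac_eq_normDet {m n : ℕ} (h : Eu m → Eu n) (y : Eu m) :
    gramJac h y = (fderiv ℝ h y).toLinearMap.normDet := by
  rw [← Real.sqrt_sq (LinearMap.normDet_nonneg _), gramJac]
  have := (fderiv ℝ h y).toLinearMap.normDet_sq_eq_det_gram (EuclideanSpace.basisFun (Fin m) ℝ)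
  simp only [RCLike.ofReal_real_eq_id, id] at this
  rw [this]
  congr 2
  ext i j
  simp [Matrix.mul_apply, Matrix.gram, PiLp.inner_apply, mul_comm]

theorem gramJac_pos {m n : ℕ} {h : Eu m → Eu n} {y : Eu m}
    (hi : Function.Injective (fderiv ℝ h y)) : 0 < gramJac h y := by
  rw [gramJac_eq_normDet]
  refine (LinearMap.normDet_nonneg _).lt_of_ne' ?_
  rw [Ne, LinearMap.normDet_eq_zero_iff_ker_ne_bot, not_not]
  exact LinearMap.ker_eq_bot.2 hi

theorem continuousOn_gramJac {m n : ℕ} {h : Eu m → Eu n} {V : Set (Eu m)} (hV : IsOpen V)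
    (hh : ContDiffOn ℝ 1 h V) : ContinuousOn (gramJac h) V := by
  have h1 : ContinuousOn (fderiv ℝ h) V := hh.continuousOn_fderiv_of_isOpen hV le_rfl
  have h2 : ContinuousOn (fun y => (Matrix.of fun (i : Fin n) (j : Fin m) =>
      fderiv ℝ h y (EuclideanSpace.single j 1) i)) V := by
    refine continuousOn_pi.2 fun i => continuousOn_pi.2 fun j => ?_
    exact (PiLp.continuous_apply 2 _ i).comp_continuousOn (h1.clm_apply continuousOn_const)
  have h3 : Continuous fun A : Matrix (Fin n) (Fin m) ℝ => √((A.transpose * A).det) := by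
    fun_prop
  exact h3.comp_continuousOn h2

theorem measure_le_of_cover {X : Type*} [MeasurableSpace X] {μ ν : Measure X} {W : ℕ → Set X}
    (hW : ∀ i, MeasurableSet (W i)) {s : Set X} (hs : MeasurableSet s) (hcov : s ⊆ ⋃ i, W i)
    (h : ∀ i, ∀ t ⊆ W i, t ⊆ s → MeasurableSet t → μ t ≤ ν t) : μ s ≤ ν s := by
  have hD : ∀ i, MeasurableSet (s ∩ disjointed W i) := fun i =>
    hs.inter (MeasurableSet.disjointed hW i)
  have hd : Pairwise (Function.onFun Disjoint fun i => s ∩ disjointed W i) := fun i j hij =>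
    (disjoint_disjointed W hij).mono inter_subset_right inter_subset_right
  have hsU : s = ⋃ i, s ∩ disjointed W i := by
    rw [← inter_iUnion, iUnion_disjointed, inter_eq_left.2 hcov]
  rw [hsU, measure_iUnion hd hD, measure_iUnion hd hD]
  exact ENNReal.tsum_le_tsum fun i => h i _
    (inter_subset_right.trans (disjointed_subset W i)) inter_subset_left (hD i)

theorem le_of_forall_one_lt_pow_mul {a b : ℝ≥0∞} (d : ℕ)
    (h : ∀ c : NNReal, 1 < c → a ≤ (c : ℝ≥0∞) ^ d * b) : a ≤ b := by
  have ht : Tendsto (fun c : NNReal => (c : ℝ≥0∞) ^ d * b) (𝓝[>] 1) (𝓝 b) := by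
    have h1 : Tendsto (fun c : NNReal => ((c ^ d : NNReal) : ℝ≥0∞)) (𝓝 1)
      (𝓝 ((1 ^ d : NNReal) : ℝ≥0∞)) :=
      (ENNReal.continuous_coe.comp (continuous_pow d)).tendsto 1
    have h2 := (ENNReal.Tendsto.mul_const (b := b) h1 (by simp)).mono_left
      (nhdsWithin_le_nhds (s := Ioi 1))
    simpa using h2
  exact ge_of_tendsto ht (eventually_nhdsWithin_of_forall fun c hc => h c hc)

end AreaFormula

theorem _root_.ContinuousOn.measurableSet_inter_preimage {X Y : Type*} [TopologicalSpace X]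
    [MeasurableSpace X] [BorelSpace X] [TopologicalSpace Y] [MeasurableSpace Y] [BorelSpace Y]
    {f : X → Y} {s : Set X} {t : Set Y} (hf : ContinuousOn f s) (hs : MeasurableSet s)
    (ht : MeasurableSet t) : MeasurableSet (s ∩ f ⁻¹' t) := by
  rw [← Subtype.image_preimage_coe]
  exact hs.subtype_image (hf.domRestrict.measurable ht)

/-! ### Area formula: from local estimates to injective immersions -/

section AreaFormula

open Filter Topology

variable {m n : ℕ} {h : Eu m → Eu n} {V : Set (Eu m)}

/-- Near a point, the area formula holds up to a factor arbitrarily close to one. -/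
theorem exists_open_area_le (hV : IsOpen V) (hh : ContDiffOn ℝ 1 h V)
    (hi : ∀ y ∈ V, Function.Injective (fderiv ℝ h y)) {c : NNReal} (hc : 1 < c) {y : Eu m}
    (hy : y ∈ V) : ∃ W, IsOpen W ∧ y ∈ W ∧ ∀ t ⊆ W, t ⊆ V → MeasurableSet t →
      μHE[m] (h '' t) ≤ c ^ (m + 1) * ∫⁻ y in t, ENNReal.ofReal (gramJac h y) ∧
      ∫⁻ y in t, ENNReal.ofReal (gramJac h y) ≤ c ^ (m + 1) * μHE[m] (h '' t) := by
  have hstrict : HasStrictFDerivAt h (fderiv ℝ h y) y :=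
    (hh.contDiffAt (hV.mem_nhds hy)).hasStrictFDerivAt one_ne_zero
  have hpos := gramJac_pos (hi y hy)
  have hcont : ContinuousAt (gramJac h) y :=
    (continuousOn_gramJac hV hh).continuousAt (hV.mem_nhds hy)
  have hc' : (1 : ℝ) < c := by exact_mod_cast hc
  have e1 : ∀ᶠ z in 𝓝 y, gramJac h z < c * gramJac h y :=
    hcont.eventually (gt_mem_nhds (by nlinarith))
  have e2 : ∀ᶠ z in 𝓝 y, gramJac h y < c * gramJac h z :=
    (Tendsto.const_mul (c : ℝ) hcont).eventually (lt_mem_nhds (by nlinarith))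
  have e3 := hstrict.eventually_edist_le (hi y hy) hc
  rw [nhds_prod_eq] at e3
  obtain ⟨T, hT, hTd⟩ := (eventually_prod_self_iff (r := fun a b =>
    edist (h a) (h b) ≤ c * edist (fderiv ℝ h y a) (fderiv ℝ h y b) ∧
      edist (fderiv ℝ h y a) (fderiv ℝ h y b) ≤ c * edist (h a) (h b))).1 e3
  obtain ⟨W, hW, hWo, hyW⟩ := mem_nhds_iff.1 (inter_mem (inter_mem e1 e2) hT)
  refine ⟨W, hWo, hyW, fun t ht htV htm => ?_⟩
  have hlin : μHE[m] (fderiv ℝ h y '' t) = ENNReal.ofReal (gramJac h y) * volume t := by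
    have := (fderiv ℝ h y).toLinearMap.euclideanHausdorffMeasure_image_eq_normDet_mul_volume t
    rw [finrank_euclideanSpace_fin] at this
    rw [gramJac_eq_normDet]
    exact this
  -- Comparing `h` with its derivative at `y` costs `c ^ m`; replacing `gramJac h y` by the varying
  -- jacobian costs one more `c`, whence the exponent `m + 1`.
  have b1 : μHE[m] (h '' t) ≤ c ^ m * μHE[m] (fderiv ℝ h y '' t) :=
    euclideanHausdorffMeasure_image_le_of_edist_le
      (fun a ha b hb => (hTd a (hW (ht ha)).2 b (hW (ht hb)).2).1) m
  have b2 : μHE[m] (fderiv ℝ h y '' t) ≤ c ^ m * μHE[m] (h '' t) :=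
    euclideanHausdorffMeasure_image_le_of_edist_le
      (fun a ha b hb => (hTd a (hW (ht ha)).2 b (hW (ht hb)).2).2) m
  have hmul : ∀ r : ℝ, (c : ℝ≥0∞) * ENNReal.ofReal r = ENNReal.ofReal (c * r) := fun r => by
    rw [ENNReal.ofReal_mul c.coe_nonneg, ENNReal.ofReal_coe_nnreal]
  have b3 : ENNReal.ofReal (gramJac h y) * volume t ≤
      c * ∫⁻ y in t, ENNReal.ofReal (gramJac h y) := by
    rw [← setLIntegral_const, ← lintegral_const_mul' _ _ ENNReal.coe_ne_top]
    refine setLIntegral_mono' htm fun z hz => ?_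
    rw [hmul]
    exact ENNReal.ofReal_le_ofReal (hW (ht hz)).1.2.le
  have b4 : ∫⁻ y in t, ENNReal.ofReal (gramJac h y) ≤
      c * (ENNReal.ofReal (gramJac h y) * volume t) := by
    rw [← mul_assoc, ← setLIntegral_const]
    refine setLIntegral_mono' htm fun z hz => ?_
    rw [hmul]
    exact ENNReal.ofReal_le_ofReal (hW (ht hz)).1.1.le
  constructor
  · calc μHE[m] (h '' t) ≤ c ^ m * (ENNReal.ofReal (gramJac h y) * volume t) := hlin ▸ b1
      _ ≤ c ^ m * (c * ∫⁻ y in t, ENNReal.ofReal (gramJac h y)) := by gcongr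
      _ = _ := by rw [pow_succ, mul_assoc]
  · calc ∫⁻ y in t, ENNReal.ofReal (gramJac h y)
        ≤ c * (ENNReal.ofReal (gramJac h y) * volume t) := b4
      _ ≤ c * (c ^ m * μHE[m] (h '' t)) := by rw [← hlin]; gcongr
      _ = _ := by rw [pow_succ', mul_assoc]

/-- The area formula for the image of a measurable set under an injective immersion. -/
theorem euclideanHausdorffMeasure_image_eq_lintegral_gramJac (hV : IsOpen V)
    (hh : ContDiffOn ℝ 1 h V) (hinj : InjOn h V)
    (hi : ∀ y ∈ V, Function.Injective (fderiv ℝ h y)) {s : Set (Eu m)} (hs : MeasurableSet s)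
    (hsV : s ⊆ V) : μHE[m] (h '' s) = ∫⁻ y in s, ENNReal.ofReal (gramJac h y) := by
  rcases V.eq_empty_or_nonempty with rfl | hne
  · simp [subset_empty_iff.1 hsV]
  have himg : ∀ t, MeasurableSet t → MeasurableSet (h '' (t ∩ V)) := fun t ht =>
    (ht.inter hV.measurableSet).image_of_continuousOn_injOn
      (hh.continuousOn.mono inter_subset_right) (hinj.mono inter_subset_right)
  -- Hausdorff measure is pulled back along `h`, so that two measures on the source are compared.
  -- Additivity rests on injectivity and on Borel images under continuous injections being Borel.
  let ν : Measure (Eu m) := Measure.ofMeasurable (fun t _ => μHE[m] (h '' (t ∩ V))) (by simp) (by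
    intro t ht hd
    rw [iUnion_inter, image_iUnion]
    refine measure_iUnion (fun i j hij => ?_) fun i => himg _ (ht i)
    rw [Function.onFun, disjoint_iff_inter_eq_empty,
      ← hinj.image_inter inter_subset_right inter_subset_right,
      ((hd hij).mono inter_subset_left inter_subset_left).inter_eq, image_empty])
  have hν : ∀ t, t ⊆ V → MeasurableSet t → ν t = μHE[m] (h '' t) := fun t htV ht => by
    rw [Measure.ofMeasurable_apply t ht, inter_eq_left.2 htV]
  let η : Measure (Eu m) := volume.withDensity fun y => ENNReal.ofReal (gramJac h y)
  have hη : ∀ t, MeasurableSet t → η t = ∫⁻ y in t, ENNReal.ofReal (gramJac h y) :=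
    fun t ht => withDensity_apply _ ht
  have key : ∀ c : NNReal, 1 < c → ν s ≤ (c : ℝ≥0∞) ^ (m + 1) * η s ∧
      η s ≤ (c : ℝ≥0∞) ^ (m + 1) * ν s := by
    intro c hc
    choose! W hWo hyW hW using fun y (hy : y ∈ V) => exists_open_area_le hV hh hi hc hy
    -- By Lindelöf, countably many of the local neighbourhoods suffice for each fixed `c`;
    -- afterwards `c` tends to one.
    obtain ⟨T, hTV, hTc, hT⟩ := TopologicalSpace.countable_cover_nhdsWithin
      (f := W) (s := V) fun y hy => mem_nhdsWithin_of_mem_nhds ((hWo y hy).mem_nhds (hyW y hy))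
    have hTne : T.Nonempty := by
      obtain ⟨y, hy⟩ := hne
      obtain ⟨i, hi, -⟩ := mem_iUnion₂.1 (hT hy)
      exact ⟨i, hi⟩
    obtain ⟨e, rfl⟩ := hTc.exists_eq_range hTne
    have heV : ∀ i, e i ∈ V := fun i => hTV (mem_range_self i)
    have hcov : s ⊆ ⋃ i, W (e i) := by
      refine (hsV.trans hT).trans ?_
      rw [biUnion_range]
    have hWm : ∀ i, MeasurableSet (W (e i)) := fun i => (hWo _ (heV i)).measurableSet
    constructor
    · refine measure_le_of_cover (ν := (c : ℝ≥0∞) ^ (m + 1) • η) hWm hs hcov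
        fun i t ht hts htm => ?_
      rw [Measure.smul_apply, smul_eq_mul, hν t (hts.trans hsV) htm, hη t htm]
      exact (hW _ (heV i) t ht (hts.trans hsV) htm).1
    · refine measure_le_of_cover (ν := (c : ℝ≥0∞) ^ (m + 1) • ν) hWm hs hcov
        fun i t ht hts htm => ?_
      rw [Measure.smul_apply, smul_eq_mul, hν t (hts.trans hsV) htm, hη t htm]
      exact (hW _ (heV i) t ht (hts.trans hsV) htm).2
  rw [← hν s hsV hs, ← hη s hs]
  exact le_antisymm (le_of_forall_one_lt_pow_mul _ fun c hc => (key c hc).1)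
    (le_of_forall_one_lt_pow_mul _ fun c hc => (key c hc).2)

/-- The area formula for an injective immersion. -/
theorem lintegral_euclideanHausdorffMeasure_image (hV : IsOpen V)
    (hh : ContDiffOn ℝ 1 h V) (hinj : InjOn h V)
    (hi : ∀ y ∈ V, Function.Injective (fderiv ℝ h y)) {F : Eu n → ℝ≥0∞} (hF : Measurable F) :
    ∫⁻ z, F z ∂(μHE[m].restrict (h '' V)) =
      ∫⁻ y in V, F (h y) * ENNReal.ofReal (gramJac h y) := by
  have hJ : AEMeasurable (fun y => ENNReal.ofReal (gramJac h y)) (volume.restrict V) :=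
    ((continuousOn_gramJac hV hh).aemeasurable hV.measurableSet).ennreal_ofReal
  have hhm : AEMeasurable h (volume.restrict V) := hh.continuousOn.aemeasurable hV.measurableSet
  have hhm' : AEMeasurable h
      ((volume.restrict V).withDensity fun y => ENNReal.ofReal (gramJac h y)) :=
    hhm.mono_ac (withDensity_absolutelyContinuous _ _)
  have hmap : μHE[m].restrict (h '' V) =
      ((volume.restrict V).withDensity fun y => ENNReal.ofReal (gramJac h y)).map h := by
    ext B hB
    have hO : MeasurableSet (V ∩ h ⁻¹' B) :=
      hh.continuousOn.measurableSet_inter_preimage hV.measurableSet hB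
    have hBnull : NullMeasurableSet (h ⁻¹' B) (volume.restrict V) :=
      hhm.nullMeasurableSet_preimage hB
    rw [Measure.map_apply_of_aemeasurable hhm' hB, withDensity_apply₀ _ hBnull,
      Measure.restrict_restrict₀ hBnull, inter_comm (h ⁻¹' B), Measure.restrict_apply hB,
      ← euclideanHausdorffMeasure_image_eq_lintegral_gramJac hV hh hinj hi hO inter_subset_left,
      image_inter_preimage, inter_comm]
  rw [hmap, lintegral_map' hF.aemeasurable hhm']
  exact (lintegral_withDensity_eq_lintegral_mul₀ hJ (hF.comp_aemeasurable hhm)).trans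
    (lintegral_congr fun y => mul_comm _ _)

end AreaFormula

/-! ### Jacobians and change of variables on `ℝᵏ × ℝᵐ` -/

section Jacobian

variable {k m : ℕ}

/-- The identification of `ℝᵏ⁺ᵐ` with `ℝᵏ × ℝᵐ`. -/
def splitEquiv (k m : ℕ) : Eu (k + m) ≃L[ℝ] Eu k × Eu m :=
  ((LinearIsometryEquiv.piLpCongrLeft 2 ℝ ℝ finSumFinEquiv.symm).trans
    (PiLp.sumPiLpEquivProdLpPiLp 2 fun _ : Fin k ⊕ Fin m => ℝ)).toContinuousLinearEquiv.trans
    (WithLp.prodContinuousLinearEquiv 2 ℝ (Eu k) (Eu m))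

/-- The map onto the `L²` product is a linear isometry. Passing to the sup-norm product afterwards
preserves volume, though not distances in general. -/
theorem measurePreserving_splitEquiv (k m : ℕ) : MeasurePreserving (splitEquiv k m) :=
  (WithLp.volume_preserving_ofLp (Eu k) (Eu m)).comp
    ((LinearIsometryEquiv.piLpCongrLeft 2 ℝ ℝ finSumFinEquiv.symm).trans
      (PiLp.sumPiLpEquivProdLpPiLp 2 fun _ : Fin k ⊕ Fin m => ℝ)).measurePreserving

theorem splitEquiv_single_inl (j : Fin k) :
    splitEquiv k m (EuclideanSpace.single (finSumFinEquiv (Sum.inl j)) 1) =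
      (EuclideanSpace.single j 1, 0) := by
  ext i
  · simp [splitEquiv]
  · simp [splitEquiv]

theorem splitEquiv_single_inr (j : Fin m) :
    splitEquiv k m (EuclideanSpace.single (finSumFinEquiv (Sum.inr j)) 1) =
      (0, EuclideanSpace.single j 1) := by
  ext i
  · simp [splitEquiv]
  · simp [splitEquiv]

theorem jac_eq_det (g : Eu k × Eu m → Eu (k + m)) (w : Eu k × Eu m) :
    jac g w = ((fderiv ℝ g w).comp (splitEquiv k m : Eu (k + m) →L[ℝ] Eu k × Eu m)).det := by
  rw [ContinuousLinearMap.det,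
    ← LinearMap.det_toMatrix (EuclideanSpace.basisFun (Fin (k + m)) ℝ).toBasis, jac]
  congr 1
  ext i j
  obtain ⟨j, rfl⟩ := finSumFinEquiv.surjective j
  rcases j with j | j
  · have := splitEquiv_single_inl (m := m) j
    simp only [finSumFinEquiv_apply_left] at this
    simp [LinearMap.toMatrix_apply, this]
  · have := splitEquiv_single_inr (k := k) j
    simp only [finSumFinEquiv_apply_right] at this
    simp [LinearMap.toMatrix_apply, this]

theorem jac_comp {f : Eu (k + m) → Eu (k + m)} {u : Eu k × Eu m → Eu (k + m)} {w : Eu k × Eu m}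
    (hf : DifferentiableAt ℝ f (u w)) (hu : DifferentiableAt ℝ u w) :
    jac (f ∘ u) w = (fderiv ℝ f (u w)).det * jac u w := by
  rw [jac_eq_det, jac_eq_det, fderiv_comp w hf hu, ContinuousLinearMap.comp_assoc]
  exact LinearMap.det_comp _ _

theorem continuousOn_jac {g : Eu k × Eu m → Eu (k + m)} {A : Set (Eu k × Eu m)} (hA : IsOpen A)
    (hg : ContDiffOn ℝ 1 g A) : ContinuousOn (jac g) A := by
  have h1 : ContinuousOn (fderiv ℝ g) A := hg.continuousOn_fderiv_of_isOpen hA le_rfl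
  simp only [funext (jac_eq_det g)]
  exact ContinuousLinearMap.continuous_det.comp_continuousOn (h1.clm_comp continuousOn_const)

/-- The change of variables formula for an injective map of an open subset of `ℝᵏ × ℝᵐ`. -/
theorem lintegral_image_eq_lintegral_abs_jac_mul {g : Eu k × Eu m → Eu (k + m)}
    {A : Set (Eu k × Eu m)} (hA : IsOpen A) (hg : ContDiffOn ℝ 1 g A) (hinj : InjOn g A)
    (F : Eu (k + m) → ℝ≥0∞) :
    ∫⁻ z in g '' A, F z = ∫⁻ w in A, F (g w) * ENNReal.ofReal |jac g w| := by
  have hA' : IsOpen (splitEquiv k m ⁻¹' A) := hA.preimage (splitEquiv k m).continuous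
  -- The change of variables formula concerns self-maps of one space, so `g` is precomposed with the
  -- volume-preserving splitting.
  have himg : g '' A = (g ∘ splitEquiv k m) '' (splitEquiv k m ⁻¹' A) := by
    rw [image_comp, image_preimage_eq _ (splitEquiv k m).surjective]
  have hd : ∀ v ∈ splitEquiv k m ⁻¹' A, HasFDerivWithinAt (g ∘ splitEquiv k m)
      ((fderiv ℝ g (splitEquiv k m v)).comp (splitEquiv k m : Eu (k + m) →L[ℝ] Eu k × Eu m))
      (splitEquiv k m ⁻¹' A) v := fun v hv =>
    (((hg.contDiffAt (hA.mem_nhds hv)).differentiableAt one_ne_zero).hasFDerivAt.comp v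
      (splitEquiv k m).hasFDerivAt).hasFDerivWithinAt
  have hinj' : InjOn (g ∘ splitEquiv k m) (splitEquiv k m ⁻¹' A) := fun v hv v' hv' e =>
    (splitEquiv k m).injective (hinj hv hv' e)
  rw [himg, lintegral_image_eq_lintegral_abs_det_fderiv_mul volume hA'.measurableSet hd hinj',
    ← (measurePreserving_splitEquiv k m).setLIntegral_comp_preimage_emb
      (splitEquiv k m).toHomeomorph.measurableEmbedding]
  refine lintegral_congr fun v => ?_
  rw [jac_eq_det, mul_comm]
  rfl

end Jacobian

theorem _root_.ContinuousOn.measurable_indicator {X : Type*} [TopologicalSpace X]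
    [MeasurableSpace X] [BorelSpace X] {f : X → ℝ≥0∞} {s : Set X} (hf : ContinuousOn f s)
    (hs : MeasurableSet s) : Measurable (s.indicator f) := by
  classical
  rw [← piecewise_eq_indicator]
  exact hf.measurable_piecewise continuousOn_const hs

/-! ### Diffeomorphisms as measured fibrations -/

section Diffeomorphism

theorem IsC1DiffeoOn.comp {E F G : Type*} [NormedAddCommGroup E] [NormedSpace ℝ E]
    [NormedAddCommGroup F] [NormedSpace ℝ F] [NormedAddCommGroup G] [NormedSpace ℝ G]
    {f : F → G} {u : E → F} {A : Set E} (hf : IsC1DiffeoOn f (u '' A)) (hu : IsC1DiffeoOn u A) :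
    IsC1DiffeoOn (f ∘ u) A := by
  obtain ⟨hA, huA, huc, i, hic, hi⟩ := hu
  obtain ⟨-, hfA, hfc, j, hjc, hj⟩ := hf
  refine ⟨hA, by rwa [image_comp], hfc.comp huc (mapsTo_image u A), i ∘ j, ?_, ?_⟩
  · rw [image_comp]
    refine hic.comp hjc ?_
    rintro _ ⟨z, hz, rfl⟩
    rwa [hj hz]
  · intro w hw
    simp only [Function.comp_apply]
    rw [hj (mem_image_of_mem u hw), hi hw]

theorem IsC1DiffeoOn.injOn {E F : Type*} [NormedAddCommGroup E] [NormedSpace ℝ E]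
    [NormedAddCommGroup F] [NormedSpace ℝ F] {g : E → F} {A : Set E} (hg : IsC1DiffeoOn g A) :
    InjOn g A := by
  obtain ⟨-, -, -, i, -, hi⟩ := hg
  exact hi.injOn

theorem IsC1DiffeoOn.hasFDerivAt {E F : Type*} [NormedAddCommGroup E] [NormedSpace ℝ E]
    [NormedAddCommGroup F] [NormedSpace ℝ F] {g : E → F} {A : Set E} (hg : IsC1DiffeoOn g A)
    {w : E} (hw : w ∈ A) : HasFDerivAt g (fderiv ℝ g w) w :=
  ((hg.2.2.1.contDiffAt (hg.1.mem_nhds hw)).differentiableAt one_ne_zero).hasFDerivAt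

/-- Differentiating `i ∘ g = id` near `w` gives a left inverse of the derivative. -/
theorem IsC1DiffeoOn.injective_fderiv {E F : Type*} [NormedAddCommGroup E] [NormedSpace ℝ E]
    [NormedAddCommGroup F] [NormedSpace ℝ F] {g : E → F} {A : Set E} (hg : IsC1DiffeoOn g A)
    {w : E} (hw : w ∈ A) : Function.Injective (fderiv ℝ g w) := by
  have hgd := hg.hasFDerivAt hw
  obtain ⟨hA, hgA, hgc, i, hic, hi⟩ := hg
  have hid : HasFDerivAt i (fderiv ℝ i (g w)) (g w) :=
    ((hic.contDiffAt (hgA.mem_nhds (mem_image_of_mem g hw))).differentiableAt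
      one_ne_zero).hasFDerivAt
  have h1 := hid.comp w hgd
  have h2 : HasFDerivAt (i ∘ g) (ContinuousLinearMap.id ℝ E) w :=
    (hasFDerivAt_id w).congr_of_eventuallyEq
      (Filter.eventually_of_mem (hA.mem_nhds hw) fun z hz => hi hz)
  have h3 := h1.unique h2
  exact Function.LeftInverse.injective (g := fderiv ℝ i (g w)) fun v =>
    congrArg (fun T : E →L[ℝ] E => T v) h3

variable {k m : ℕ} {g : Eu k × Eu m → Eu (k + m)} {U : Set (Eu k)} {V : Set (Eu m)}

theorem IsC1DiffeoOn.jac_ne_zero {A : Set (Eu k × Eu m)} (hg : IsC1DiffeoOn g A)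
    {w : Eu k × Eu m} (hw : w ∈ A) : jac g w ≠ 0 := by
  rw [jac_eq_det, ContinuousLinearMap.det, ← isUnit_iff_ne_zero,
    ← LinearMap.isUnit_iff_isUnit_det, LinearMap.isUnit_iff_ker_eq_bot, LinearMap.ker_eq_bot]
  exact (hg.injective_fderiv hw).comp (splitEquiv k m).injective

theorem IsC1DiffeoOn.fderiv_slice (hg : IsC1DiffeoOn g (U ×ˢ V)) {w : Eu k × Eu m}
    (hw : w ∈ U ×ˢ V) : fderiv ℝ (fun y => g (w.1, y)) w.2 =
      (fderiv ℝ g w).comp (ContinuousLinearMap.inr ℝ (Eu k) (Eu m)) :=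
  ((hg.hasFDerivAt hw).comp w.2 (hasFDerivAt_prodMk_right w.1 w.2)).fderiv

theorem IsC1DiffeoOn.injective_fderiv_slice (hg : IsC1DiffeoOn g (U ×ˢ V)) {w : Eu k × Eu m}
    (hw : w ∈ U ×ˢ V) : Function.Injective (fderiv ℝ (fun y => g (w.1, y)) w.2) := by
  rw [hg.fderiv_slice hw]
  exact (hg.injective_fderiv hw).comp (Prod.mk_right_injective (0 : Eu k))

theorem IsC1DiffeoOn.contDiffOn_slice (hg : IsC1DiffeoOn g (U ×ˢ V)) {x : Eu k} (hx : x ∈ U) :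
    ContDiffOn ℝ 1 (fun y => g (x, y)) V :=
  hg.2.2.1.comp (contDiff_prodMk_right x).contDiffOn fun _ hy => ⟨hx, hy⟩

theorem IsC1DiffeoOn.injOn_slice (hg : IsC1DiffeoOn g (U ×ˢ V)) {x : Eu k} (hx : x ∈ U) :
    InjOn (fun y => g (x, y)) V := fun _ hy _ hy' e =>
  congrArg Prod.snd (hg.injOn (mk_mem_prod hx hy) (mk_mem_prod hx hy') e)

theorem IsC1DiffeoOn.jacY_pos (hg : IsC1DiffeoOn g (U ×ˢ V)) {w : Eu k × Eu m}
    (hw : w ∈ U ×ˢ V) : 0 < jacY g w :=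
  gramJac_pos (hg.injective_fderiv_slice hw)

/-- The slice derivative is the full derivative restricted to `{0} × ℝᵐ`, which gives continuity
jointly in `(x, y)`, not just along fibres. -/
theorem IsC1DiffeoOn.continuousOn_jacY (hg : IsC1DiffeoOn g (U ×ˢ V)) :
    ContinuousOn (jacY g) (U ×ˢ V) := by
  have h1 : ContinuousOn (fderiv ℝ g) (U ×ˢ V) :=
    hg.2.2.1.continuousOn_fderiv_of_isOpen hg.1 le_rfl
  have h2 : ContinuousOn (fun w => (Matrix.of fun (i : Fin (k + m)) (j : Fin m) =>
      fderiv ℝ g w (0, EuclideanSpace.single j 1) i)) (U ×ˢ V) := by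
    refine continuousOn_pi.2 fun i => continuousOn_pi.2 fun j => ?_
    exact (PiLp.continuous_apply 2 _ i).comp_continuousOn (h1.clm_apply continuousOn_const)
  have h3 : Continuous fun A : Matrix (Fin (k + m)) (Fin m) ℝ => √((A.transpose * A).det) := by
    fun_prop
  refine (h3.comp_continuousOn h2).congr fun w hw => ?_
  rw [jacY, gramJac, hg.fderiv_slice hw]
  rfl

/-- The images of the sets `{x} × V` under a diffeomorphism of `U × V` are the fibres of a fibration
in the sense of measures. -/
theorem IsC1DiffeoOn.isFibered (hg : IsC1DiffeoOn g (U ×ˢ V)) (hU : IsOpen U) (hV : IsOpen V)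
    (hVne : V.Nonempty) :
    IsFibered volume volume volume U V g
      ((U ×ˢ V).indicator fun w => ENNReal.ofReal |jac g w|)
      ((U ×ˢ V).indicator fun w => ENNReal.ofReal (jacY g w))
      (fun x => μHE[m].restrict ((fun y => g (x, y)) '' V)) := by
  have hW : MeasurableSet (U ×ˢ V) := hg.1.measurableSet
  have hgm : AEMeasurable g (volume.restrict (U ×ˢ V)) := hg.2.2.1.continuousOn.aemeasurable hW
  have hJ : ContinuousOn (fun w => ENNReal.ofReal |jac g w|) (U ×ˢ V) :=
    ENNReal.continuous_ofReal.comp_continuousOn (continuousOn_jac hg.1 hg.2.2.1).abs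
  have ha : ContinuousOn (fun w => ENNReal.ofReal (jacY g w)) (U ×ˢ V) :=
    ENNReal.continuous_ofReal.comp_continuousOn hg.continuousOn_jacY
  refine ⟨hU.measurableSet, hV.measurableSet, (hV.measure_pos _ hVne).ne', ?_, ?_, ?_, ?_, ?_, ?_,
    ?_, ?_, ?_, hg.2.1.measurableSet, ?_⟩
  -- Extension by zero makes the jacobians Borel on the whole product.
  · exact hJ.measurable_indicator hW
  · exact ha.measurable_indicator hW
  · intro x hx y hy
    rw [indicator_of_mem (mk_mem_prod hx hy)]
    simpa using hg.jac_ne_zero (mk_mem_prod hx hy)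
  · intro x hx y hy
    rw [indicator_of_mem (mk_mem_prod hx hy)]
    exact ENNReal.ofReal_ne_top
  · intro x hx y hy
    rw [indicator_of_mem (mk_mem_prod hx hy)]
    simpa using hg.jacY_pos (mk_mem_prod hx hy)
  · intro x hx y hy
    rw [indicator_of_mem (mk_mem_prod hx hy)]
    exact ENNReal.ofReal_ne_top
  · intro F hF
    rw [lintegral_image_eq_lintegral_abs_jac_mul hg.1 hg.2.2.1 hg.injOn, Measure.volume_eq_prod,
      setLIntegral_prod]
    · refine setLIntegral_congr_fun hU.measurableSet fun x hx =>
        setLIntegral_congr_fun hV.measurableSet fun y hy => ?_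
      rw [indicator_of_mem (mk_mem_prod hx hy)]
    · exact (hF.comp_aemeasurable hgm).mul (hJ.aemeasurable hW)
  · intro x hx F hF
    rw [lintegral_euclideanHausdorffMeasure_image hV (hg.contDiffOn_slice hx) (hg.injOn_slice hx)
      (fun y hy => hg.injective_fderiv_slice (mk_mem_prod hx hy)) hF]
    refine setLIntegral_congr_fun hV.measurableSet fun y hy => ?_
    rw [indicator_of_mem (mk_mem_prod hx hy)]
    rfl
  · exact fun x hx => (hg.contDiffOn_slice hx).continuousOn.aemeasurable hV.measurableSet
  · intro G hG
    obtain ⟨-, hgA, -, i, hic, hi⟩ := hg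
    classical
    -- The inverse, extended by a constant, is globally Borel; composing `G` with it gives the lift.
    have him : Measurable ((g '' (U ×ˢ V)).piecewise i fun _ => 0) :=
      hic.continuousOn.measurable_piecewise continuousOn_const hgA.measurableSet
    refine ⟨_, (hG.comp him).indicator hgA.measurableSet, fun w hw => ?_,
      fun z hz => indicator_of_notMem hz _⟩
    have hmem := mem_image_of_mem g hw
    rw [indicator_of_mem hmem, Function.comp_apply, piecewise_eq_of_mem _ _ _ hmem, hi hw]

end Diffeomorphism

/-! ### Translation into the abstract setting -/

section Fibers

variable {k m : ℕ} {g : Eu k × Eu m → Eu (k + m)} {U : Set (Eu k)} {V : Set (Eu m)} {q : ℝ}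

theorem surfaceMeasures_mapFamily (u : Eu k × Eu m → Eu (k + m)) (f : Eu (k + m) → Eu (k + m)) :
    surfaceMeasures m (mapFamily f (surfaces U V u)) =
      (fun x => μHE[m].restrict ((fun y => (f ∘ u) (x, y)) '' V)) '' U := by
  have himg : ∀ x, f '' {z | ∃ y ∈ V, u (x, y) = z} = (fun y => (f ∘ u) (x, y)) '' V := fun x => by
    rw [show {z | ∃ y ∈ V, u (x, y) = z} = (fun y => u (x, y)) '' V from rfl, image_image]
    rfl
  ext μ
  constructor
  · rintro ⟨_, ⟨_, ⟨x, hx, rfl⟩, rfl⟩, rfl⟩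
    exact ⟨x, hx, by rw [himg]⟩
  · rintro ⟨x, hx, rfl⟩
    exact ⟨_, ⟨_, ⟨x, hx, rfl⟩, rfl⟩, by rw [himg]⟩

theorem IsC1DiffeoOn.ratio_eq (hg : IsC1DiffeoOn g (U ×ˢ V)) {w : Eu k × Eu m}
    (hw : w ∈ U ×ˢ V) (r : ℝ) :
    ENNReal.ofReal ((jacY g w / |jac g w|) ^ r) =
      ((U ×ˢ V).indicator (fun w => ENNReal.ofReal (jacY g w)) w /
        (U ×ˢ V).indicator (fun w => ENNReal.ofReal |jac g w|) w) ^ r := by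
  have hJ : 0 < |jac g w| := abs_pos.2 (hg.jac_ne_zero hw)
  rw [indicator_of_mem hw, indicator_of_mem hw, ← ENNReal.ofReal_div_of_pos hJ,
    ENNReal.ofReal_rpow_of_pos (div_pos (hg.jacY_pos hw) hJ)]

theorem IsC1DiffeoOn.ell_eq_fiberEnergy (hg : IsC1DiffeoOn g (U ×ˢ V)) (hV : MeasurableSet V)
    {x : Eu k} (hx : x ∈ U) :
    ell q V g x = fiberEnergy q volume V ((U ×ˢ V).indicator fun w => ENNReal.ofReal |jac g w|)
      ((U ×ˢ V).indicator fun w => ENNReal.ofReal (jacY g w)) x := by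
  refine setLIntegral_congr_fun hV fun y hy => ?_
  have hw : (x, y) ∈ U ×ˢ V := ⟨hx, hy⟩
  have hpos : 0 ≤ jacY g (x, y) / |jac g (x, y)| := div_nonneg (hg.jacY_pos hw).le (abs_nonneg _)
  rw [ENNReal.ofReal_mul (Real.rpow_nonneg hpos _), hg.ratio_eq hw, energy]
  congr 1
  rw [indicator_of_mem hw]

end Fibers

end SurfaceModulus

end

theorem corollary3p2 {k m : ℕ} {p q : ℝ} (hpq : p.HolderConjugate q)
    (U : Set (SurfaceModulus.Eu k)) (V : Set (SurfaceModulus.Eu m))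
    (hUo : IsOpen U) (hUc : IsConnected U) (hVo : IsOpen V) (hVc : IsConnected V)
    (u : SurfaceModulus.Eu k × SurfaceModulus.Eu m → SurfaceModulus.Eu (k + m))
    (hu : SurfaceModulus.IsC1DiffeoOn u (U ×ˢ V))
    (f : SurfaceModulus.Eu (k + m) → SurfaceModulus.Eu (k + m))
    (hf : SurfaceModulus.IsC1DiffeoOn f (u '' (U ×ˢ V)))
    (S : Set (Set (SurfaceModulus.Eu (k + m))))
    (hS : S = SurfaceModulus.mapFamily f (SurfaceModulus.surfaces U V u)) :
    -- the jacobian of `f ∘ u` is `(J_f ∘ u) J_u`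
    (∀ w ∈ U ×ˢ V, SurfaceModulus.jac (f ∘ u) w =
      (fderiv ℝ f (u w)).det * SurfaceModulus.jac u w) ∧
    -- the formula for the modulus
    SurfaceModulus.surfaceModulus p m S =
      ∫⁻ x in U, SurfaceModulus.ell q V (f ∘ u) x ^ (1 - p) ∧
    -- the given function is extremal, up to a subfamily of modulus zero
    SurfaceModulus.IsExtremalUpToNull p volume (SurfaceModulus.surfaceMeasures m S)
      (SurfaceModulus.density q U V (f ∘ u)) ∧
    -- it is extremal for the whole family if `l` is finite
    ((∀ x ∈ U, SurfaceModulus.ell q V (f ∘ u) x ≠ ∞) →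
      SurfaceModulus.IsExtremal p volume (SurfaceModulus.surfaceMeasures m S)
        (SurfaceModulus.density q U V (f ∘ u))) ∧
    -- it is the only extremal function if the modulus is finite
    (SurfaceModulus.surfaceModulus p m S ≠ ∞ →
      ∀ ρ : SurfaceModulus.Eu (k + m) → ℝ≥0∞,
        SurfaceModulus.IsExtremalUpToNull p volume
          (SurfaceModulus.surfaceMeasures m S) ρ →
        ρ =ᵐ[volume] SurfaceModulus.density q U V (f ∘ u)) := by
  subst hS
  have hg : SurfaceModulus.IsC1DiffeoOn (f ∘ u) (U ×ˢ V) := hf.comp hu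
  have hfib := hg.isFibered hUo hVo hVc.nonempty
  have hell : ∀ x ∈ U, SurfaceModulus.ell q V (f ∘ u) x = _ := fun x hx =>
    hg.ell_eq_fiberEnergy hVo.measurableSet hx
  have hext := hfib.extremal hpq (F := SurfaceModulus.density q U V (f ∘ u))
    (fun w hw => by
      rw [SurfaceModulus.density, indicator_of_mem (mem_image_of_mem _ hw)]
      dsimp only
      -- Injectivity of `f ∘ u` makes the chosen preimage in `density` equal to `w`.
      rw [hg.injOn.leftInvOn_invFunOn hw, hell _ hw.1, hg.ratio_eq hw])
    (fun z hz => indicator_of_notMem hz _)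
  rw [← SurfaceModulus.surfaceMeasures_mapFamily] at hext
  obtain ⟨hmod, hnull, hfin⟩ := hext
  refine ⟨fun w hw => SurfaceModulus.jac_comp
    (hf.hasFDerivAt (mem_image_of_mem u hw)).differentiableAt (hu.hasFDerivAt hw).differentiableAt,
    ?_, hnull, fun h => hfin fun x hx => hell x hx ▸ h x hx,
    fun h ρ hρ => hρ.ae_eq hpq.lt h hnull⟩
  rw [SurfaceModulus.surfaceModulus, hmod]
  exact setLIntegral_congr_fun hUo.measurableSet fun x hx => by rw [hell x hx]
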